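/- All graphs are finite and simple. For a graph $G$, let $\mathrm{lpt}(G)$ be the minimum cardinality of a set of vertices of $G$ that intersects every longest path of $G$. A graph is chordal if each of its induced cycles has length three, and planar if it can be embedded in the plane. A $3$-tree is a graph obtained from a complete graph on three vertices by repeatedly (zero or more times) adding a new vertex whose neighbours are exactly the vertices of a $3$-clique of the graph constructed so far. If $G$ is a $3$-tree or a connected chordal planar graph, then $\mathrm{lpt}(G) \leq 2$. -/

import Mathlib

namespace SimpleGraph

variable {V : Type*}

/-- `p` is a longest path of `G`: a path of maximum length among all paths of `G`. -/
def IsLongestPath (G : SimpleGraph V) {u v : V} (p : G.Walk u v) : Prop :=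
  p.IsPath ∧ ∀ (x y : V) (q : G.Walk x y), q.IsPath → q.length ≤ p.length

/-- `S` is a longest path transversal: it meets every longest path of `G`. -/
def IsLongestPathTransversal (G : SimpleGraph V) (S : Finset V) : Prop :=
  ∀ (u v : V) (p : G.Walk u v), G.IsLongestPath p → ∃ w ∈ S, w ∈ p.support

/-- The minimum cardinality of a longest path transversal of the finite graph `G`. -/
noncomputable def lpt [Fintype V] (G : SimpleGraph V) : ℕ :=
  sInf {n : ℕ | ∃ S : Finset V, G.IsLongestPathTransversal S ∧ S.card = n}

/-- The infimum in the definition of `lpt` is over a nonempty set, hence it is attained. -/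
theorem exists_transversal_card_eq_lpt [Fintype V] (G : SimpleGraph V) :
    ∃ S : Finset V, G.IsLongestPathTransversal S ∧ S.card = G.lpt :=
  Nat.sInf_mem (s := {n : ℕ | ∃ S : Finset V, G.IsLongestPathTransversal S ∧ S.card = n})
    ⟨_, Finset.univ, fun u _ p _ => ⟨u, Finset.mem_univ u, p.start_mem_support⟩, rfl⟩

/-- Every induced (that is, chordless) cycle has length three. -/
def IsChordal (G : SimpleGraph V) : Prop :=
  ∀ (v : V) (c : G.Walk v v), c.IsCycle → c.IsChordless → c.length = 3

/-- `G.IsKTreeOn k S` says that the subgraph of `G` induced by `S` is a `k`-tree: it is a complete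
graph on `k` vertices, or it arises from a `k`-tree by adding a new vertex `v` whose neighbours
are exactly the vertices of a `k`-clique of the `k`-tree. -/
inductive IsKTreeOn (G : SimpleGraph V) (k : ℕ) : Set V → Prop
  | base (K : Finset V) (hK : G.IsNClique k K) : IsKTreeOn G k (K : Set V)
  | step (S : Set V) (v : V) (K : Finset V) (hS : IsKTreeOn G k S) (hv : v ∉ S)
      (hKS : (K : Set V) ⊆ S) (hK : G.IsNClique k K)
      (hadj : ∀ u ∈ S, G.Adj v u ↔ u ∈ K) : IsKTreeOn G k (insert v S)

/-- `G` is a `k`-tree. -/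
def IsKTree (G : SimpleGraph V) (k : ℕ) : Prop :=
  G.IsKTreeOn k Set.univ

/-- A planar embedding of `G`: vertices are distinct points of the plane, the edge `uv` is a simple
arc joining the points of `u` and `v`, an arc contains no vertex other than its two ends, and
two distinct arcs meet only in common ends. -/
structure PlaneEmbedding (G : SimpleGraph V) where
  point : V → EuclideanSpace ℝ (Fin 2)
  arc : G.edgeSet → Set (EuclideanSpace ℝ (Fin 2))
  point_injective : Function.Injective point
  isArc : ∀ (u v : V) (h : G.Adj u v), ∃ γ : _root_.Path (point u) (point v),
    Function.Injective γ ∧ Set.range γ = arc ⟨s(u, v), h⟩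
  mem_of_point_mem_arc : ∀ (e : G.edgeSet) (w : V), point w ∈ arc e → w ∈ (e : Sym2 V)
  arc_inter_arc : ∀ e f : G.edgeSet, e ≠ f →
    arc e ∩ arc f ⊆ point '' {w : V | w ∈ (e : Sym2 V) ∧ w ∈ (f : Sym2 V)}

/-- `G` is planar: it can be embedded in the plane. -/
def IsPlanar (G : SimpleGraph V) : Prop :=
  Nonempty G.PlaneEmbedding

end SimpleGraph

/-! ### Paths as vertex lists: splitting and joining -/

namespace SimpleGraph

variable {V : Type*} {G : SimpleGraph V} {L : ℕ}

/-! Two properties of both graph classes suffice: there is no 5-clique, and `HasCones` holds, that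
is, whatever a clique separator cuts off contains a vertex adjacent to all separator vertices that
see it. For connected graphs with these properties `lpt_le_two_of_hasCones` gives the bound.

Suppose no two vertices meet all longest paths, so any two vertices are avoided by some longest
path, while any two longest paths intersect. Then every clique `S` with at most three vertices has a
component of its complement that holds a longest path, or, when `S` is a triangle, nearly holds one
for two choices of an extra vertex of `S` (`exists_captures`). Take a smallest such captured
component, over all `S`, and let `v` be a cone of it; `K = S ∪ {v}` is a clique. By minimality, a
captured component avoiding `K`, for a subset of `K` with at most three vertices, is disjoint from
the chosen one, and this yields longest paths that do not meet. This rules out `|S| < 3`. For `|S| =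
3` it forces, for each `r` in `K`, the component captured by `K \ {r}` to contain `r`. Every `r` is
thus the head of two "arrows" `x → r`: longest paths meeting `K` only in `x` and `r` and otherwise
staying in components that `r` touches.

Exchanging halves of such paths shows that some component of `G - K` is touched by all four vertices
of `K` (`exists_forall_touches_of_hasArrow`). Its cone completes `K` to a 5-clique, a contradiction
(`false_of_captures`).

It remains to check the two properties. Cones exist in k-trees by induction on the construction, and
in chordal graphs by maximising the number of neighbours in the separator. A 3-tree has no 5-clique
by construction. A planar graph has none by a winding number form of the van Kampen obstruction
(`false_of_five_points`). -/

/-- The list `l` is the list of vertices of a (possibly empty) path of `G`. -/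
def IsPathList (G : SimpleGraph V) (l : List V) : Prop :=
  l.Nodup ∧ l.IsChain G.Adj

theorem IsPathList.singleton (x : V) : G.IsPathList [x] :=
  ⟨List.nodup_singleton x, List.isChain_singleton x⟩

theorem IsPathList.reverse {l : List V} (h : G.IsPathList l) : G.IsPathList l.reverse := by
  refine ⟨List.nodup_reverse.2 h.1, ?_⟩
  rw [List.isChain_reverse]
  exact h.2.imp fun a b hab => hab.symm

theorem IsPathList.left_of_append {l m : List V} (h : G.IsPathList (l ++ m)) : G.IsPathList l :=
  ⟨(List.nodup_append.1 h.1).1, h.2.left_of_append⟩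

theorem IsPathList.right_of_append {l m : List V} (h : G.IsPathList (l ++ m)) : G.IsPathList m :=
  ⟨(List.nodup_append.1 h.1).2.1, h.2.right_of_append⟩

theorem IsPathList.tail {x : V} {l : List V} (h : G.IsPathList (x :: l)) : G.IsPathList l :=
  IsPathList.right_of_append (l := [x]) h

/-- Two disjoint paths whose first vertices are adjacent can be joined. -/
theorem IsPathList.join {x y : V} {A B : List V} (hA : G.IsPathList (x :: A))
    (hB : G.IsPathList (y :: B)) (hxy : G.Adj x y) (hd : ∀ a ∈ x :: A, a ∉ y :: B) :
    G.IsPathList (A.reverse ++ x :: y :: B) := by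
  have hA' := hA.reverse
  rw [List.reverse_cons] at hA'
  have e : A.reverse ++ x :: y :: B = (A.reverse ++ [x]) ++ y :: B := by simp
  rw [e]
  refine ⟨List.nodup_append.2 ⟨hA'.1, hB.1, ?_⟩, ?_⟩
  · intro a ha b hb hab
    subst hab
    exact hd a (by simp at ha ⊢; tauto) hb
  · refine List.IsChain.append hA'.2 hB.2 ?_
    intro a ha b hb
    simp at ha hb
    subst ha hb
    exact hxy

/-- A path splits at each of its vertices into two tails, the second of which may be taken to be
the longer one. -/
theorem IsPathList.exists_split {l : List V} (h : G.IsPathList l) {x : V} (hx : x ∈ l) :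
    ∃ A B : List V, G.IsPathList (x :: A) ∧ G.IsPathList (x :: B) ∧ (∀ a ∈ A, a ∉ B) ∧
      l.length = A.length + B.length + 1 ∧ A.length ≤ B.length ∧
      ∀ a, a ∈ l ↔ a = x ∨ a ∈ A ∨ a ∈ B := by
  obtain ⟨s, t, rfl⟩ := List.append_of_mem hx
  have h1 : G.IsPathList (x :: s.reverse) := by
    have : G.IsPathList (s ++ [x]) := by
      apply IsPathList.left_of_append (m := t); simpa using h
    simpa using this.reverse
  have h2 : G.IsPathList (x :: t) := h.right_of_append
  have hd : ∀ a ∈ s, a ∉ t := by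
    intro a ha hb
    exact (List.nodup_append.1 h.1).2.2 a ha a (List.mem_cons_of_mem _ hb) rfl
  rcases le_total s.length t.length with hl | hl
  · refine ⟨s.reverse, t, h1, h2, by simpa using hd, ?_, by simpa using hl, ?_⟩
    · simp; omega
    · intro a; simp; tauto
  · refine ⟨t, s.reverse, h2, h1, ?_, ?_, by simpa using hl, ?_⟩
    · intro a ha hb; exact hd a (by simpa using hb) ha
    · simp; omega
    · intro a; simp; tauto

theorem IsPathList.notMem_of_cons {x : V} {l : List V} (h : G.IsPathList (x :: l)) : x ∉ l :=
  (List.nodup_cons.1 h.1).1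

/-- The list `l` is a path of `G` with `L` vertices. -/
def IsPathOfCard (G : SimpleGraph V) (L : ℕ) (l : List V) : Prop :=
  G.IsPathList l ∧ l.length = L

/-- The exchange inequality behind the length contradictions at a clique: tails of two longest paths
that start at different clique vertices may be joined through the edge between them. The 2 counts
`x` and `y`. -/
theorem add_length_le_of_adj (hL : ∀ l, G.IsPathList l → l.length ≤ L) {x y : V} {A B : List V}
    (hA : G.IsPathList (x :: A)) (hB : G.IsPathList (y :: B)) (hxy : G.Adj x y)
    (hd : ∀ a ∈ x :: A, a ∉ y :: B) : A.length + B.length + 2 ≤ L := by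
  have := hL _ (hA.join hB hxy hd)
  simp at this; omega

/-! ### Components of the complement of a vertex set -/

/-- The vertex set of the component of `G - S` that contains `c` (where `c ∉ S`). -/
def complComp (G : SimpleGraph V) (S : Set V) (c : V) : Set V :=
  {u | Relation.ReflTransGen (fun a b => G.Adj a b ∧ a ∉ S ∧ b ∉ S) c u}

/-- The vertex `r` has a neighbour in the component of `G - S` that contains `c`. -/
def Touches (G : SimpleGraph V) (S : Set V) (c r : V) : Prop :=
  ∃ u ∈ G.complComp S c, G.Adj r u

theorem self_mem_complComp (S : Set V) (c : V) : c ∈ G.complComp S c :=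
  Relation.ReflTransGen.refl

theorem notMem_of_mem_complComp {S : Set V} {c u : V} (hc : c ∉ S) (hu : u ∈ G.complComp S c) :
    u ∉ S := by
  induction hu with
  | refl => exact hc
  | tail _ h _ => exact h.2.2

theorem complComp_eq_of_mem {S : Set V} {c u : V} (hu : u ∈ G.complComp S c) :
    G.complComp S u = G.complComp S c := by
  have hs : Relation.ReflTransGen (fun a b => G.Adj a b ∧ a ∉ S ∧ b ∉ S) u c := by
    induction hu with
    | refl => exact Relation.ReflTransGen.refl
    | tail _ h ih => exact Relation.ReflTransGen.head ⟨h.1.symm, h.2.2, h.2.1⟩ ih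
  ext w
  exact ⟨fun h => Relation.ReflTransGen.trans hu h, fun h => Relation.ReflTransGen.trans hs h⟩

theorem mem_complComp_of_adj {S : Set V} {c u w : V} (hc : c ∉ S) (hu : u ∈ G.complComp S c)
    (h : G.Adj u w) (hw : w ∉ S) : w ∈ G.complComp S c :=
  Relation.ReflTransGen.tail hu ⟨h, notMem_of_mem_complComp hc hu, hw⟩

theorem complComp_anti {S T : Set V} (h : S ⊆ T) (c : V) :
    G.complComp T c ⊆ G.complComp S c := fun _ hu =>
  Relation.ReflTransGen.mono (fun _ _ hab => ⟨hab.1, fun h' => hab.2.1 (h h'),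
    fun h' => hab.2.2 (h h')⟩) _ _ hu

/-- A connected set that avoids `S` and meets a component of `G - S` lies in it. -/
theorem complComp_subset_of_disjoint {S T : Set V} {c d u : V} (hd : d ∉ T)
    (hS : ∀ w ∈ G.complComp T d, w ∉ S) (hu : u ∈ G.complComp T d) (hu' : u ∈ G.complComp S c) :
    G.complComp T d ⊆ G.complComp S c := by
  intro w hw
  rw [← complComp_eq_of_mem hu] at hw
  induction hw with
  | refl => exact hu'
  | @tail b e hb hbe ih =>
    have hb' : b ∈ G.complComp T d := Relation.ReflTransGen.trans hu hb
    exact Relation.ReflTransGen.tail ih ⟨hbe.1, hS _ hb',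
      hS _ (mem_complComp_of_adj hd hb' hbe.1 hbe.2.2)⟩

theorem IsPathList.subset_of_cons {S : Set V} {c x : V} {A : List V} (hc : c ∉ S)
    (h : G.IsPathList (x :: A)) (hx : x ∈ G.complComp S c) (hA : ∀ a ∈ A, a ∉ S) :
    ∀ a ∈ A, a ∈ G.complComp S c := by
  induction A generalizing x with
  | nil => simp
  | cons y A ih =>
    have hxy : G.Adj x y := by
      have := h.2; rw [List.isChain_cons_cons] at this; exact this.1
    have hy := mem_complComp_of_adj hc hx hxy (hA y (by simp))
    intro a ha
    rcases List.mem_cons.1 ha with rfl | ha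
    · exact hy
    · exact ih h.tail hy (fun a ha => hA a (by simp [ha])) a ha

/-- A path that avoids `S` and meets a component of `G - S` lies in it. -/
theorem IsPathList.subset_complComp {S : Set V} {c x : V} {l : List V} (hc : c ∉ S)
    (h : G.IsPathList l) (hx : x ∈ l) (hx' : x ∈ G.complComp S c) (hl : ∀ a ∈ l, a ∉ S) :
    ∀ a ∈ l, a ∈ G.complComp S c := by
  obtain ⟨A, B, hA, hB, -, -, -, hm⟩ := h.exists_split hx
  intro a ha
  rcases (hm a).1 ha with rfl | ha | ha
  · exact hx'
  · exact hA.subset_of_cons hc hx' (fun a ha => hl a ((hm a).2 (by tauto))) a ha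
  · exact hB.subset_of_cons hc hx' (fun a ha => hl a ((hm a).2 (by tauto))) a ha

theorem Touches.of_mem {S : Set V} {c u r : V} (hu : u ∈ G.complComp S c)
    (h : G.Touches S u r) : G.Touches S c r := by
  obtain ⟨w, hw, hr⟩ := h
  exact ⟨w, by rwa [complComp_eq_of_mem hu] at hw, hr⟩

/-- If the rest of a path avoids `S` and meets a component of `G - S`, the first vertex of the path
touches that component. -/
theorem IsPathList.touches_of_cons {S : Set V} {c x u : V} {A : List V} (hc : c ∉ S)
    (h : G.IsPathList (x :: A)) (hA : ∀ a ∈ A, a ∉ S) (hu : u ∈ A)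
    (hu' : u ∈ G.complComp S c) : G.Touches S c x := by
  have hs := h.tail.subset_complComp hc hu hu' hA
  cases A with
  | nil => simp at hu
  | cons y A =>
    refine ⟨y, hs y (by simp), ?_⟩
    have := h.2; rw [List.isChain_cons_cons] at this; exact this.1

/-! ### Arrows on a 4-clique and long tails -/

/-- Some longest path meets the clique `K` in `x` and `z` only, and visits only those components
of `G - K` that `z` touches. -/
def HasArrow (G : SimpleGraph V) (L : ℕ) (K : Set V) (x z : V) : Prop :=
  ∃ P, G.IsPathOfCard L P ∧ (∀ a ∈ P, a ∈ K → a = x ∨ a = z) ∧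
    ∀ a ∈ P, a ∉ K → G.Touches K a z

/-- Some path that starts in `K` and continues in the component of `c` in `G - K` covers more than
half of the length of a longest path. -/
def HasLongTail (G : SimpleGraph V) (L : ℕ) (K : Set V) (c : V) : Prop :=
  ∃ k ∈ K, ∃ B, G.IsPathList (k :: B) ∧ (∀ b ∈ B, b ∈ G.complComp K c) ∧ L + 1 ≤ 2 * B.length

theorem IsPathList.exists_split_of_mem {l : List V} (h : G.IsPathList l) {x c : V} (hx : x ∈ l)
    (hc : c ∈ l) (hcx : c ≠ x) :
    ∃ A B : List V, G.IsPathList (x :: A) ∧ G.IsPathList (x :: B) ∧ (∀ a ∈ A, a ∉ B) ∧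
      l.length = A.length + B.length + 1 ∧ c ∈ B ∧ ∀ a, a ∈ l ↔ a = x ∨ a ∈ A ∨ a ∈ B := by
  obtain ⟨A, B, hA, hB, hd, hl, -, hm⟩ := h.exists_split hx
  rcases (hm c).1 hc with h | h | h
  · exact absurd h hcx
  · exact ⟨B, A, hB, hA, fun a ha hb => hd a hb ha, by omega, h, fun a => by rw [hm a]; tauto⟩
  · exact ⟨A, B, hA, hB, hd, hl, h, hm⟩

/-- A path which meets `K` in `y` only and visits a component not touched by `y` stays in it. -/
theorem IsPathList.subset_complComp_of_not_touches {K : Set V} {D : List V} {y e u : V}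
    (he : e ∉ K) (hD : G.IsPathList D) (hDK : ∀ a ∈ D, a ∈ K → a = y) (hu : u ∈ D)
    (hu' : u ∈ G.complComp K e) (hy : ¬ G.Touches K e y) : ∀ a ∈ D, a ∈ G.complComp K e := by
  have huK := notMem_of_mem_complComp he hu'
  have hyD : ∀ a ∈ D, a ∉ K := by
    intro a ha haK
    obtain rfl := hDK a ha haK
    obtain ⟨A, B, -, hB, -, -, huB, hm⟩ :=
      hD.exists_split_of_mem ha hu (fun h => huK (h ▸ haK))
    refine hy (hB.touches_of_cons he (fun b hb hbK => ?_) huB hu')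
    have := hDK b ((hm b).2 (by tauto)) hbK
    exact hB.notMem_of_cons (this ▸ hb)
  exact hD.subset_complComp he hu hu' hyD

/-- The path of the arrow meets `K` at most in `u` and `r`, both different from `w`, so it must meet
`Q` outside `K`; there it only visits components touched by its head. -/
theorem exists_touches_of_hasArrow {K : Set V}
    (hint : ∀ P Q, G.IsPathOfCard L P → G.IsPathOfCard L Q → ∃ c ∈ P, c ∈ Q)
    {Q : List V} (hQ : G.IsPathOfCard L Q) {w r u : V} (hQK : ∀ a ∈ Q, a ∈ K → a = w)
    (hrw : r ≠ w) (huw : u ≠ w) (h : G.HasArrow L K u r) :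
    ∃ c ∈ Q, c ∉ K ∧ G.Touches K c r := by
  obtain ⟨P, hP, hPK, hPr⟩ := h
  obtain ⟨c, hcP, hcQ⟩ := hint P Q hP hQ
  have hcK : c ∉ K := by
    intro hcK
    have h1 := hQK c hcQ hcK
    rcases hPK c hcP hcK with h2 | h2
    · exact huw (h2 ▸ h1)
    · exact hrw (h2 ▸ h1)
  exact ⟨c, hcQ, hcK, hPr c hcP hcK⟩

/-- Since `y` does not touch the component of `c`, the path `Q` can enter it only through `w`, and
the part `B` of `Q` beyond `w` is confined to it. Comparing the other part `Q1` with `P` shows that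
`B` is the long one. -/
theorem hasLongTail_of_not_touches {K : Set V} {x z y w c : V} {P Q : List V}
    (hL : ∀ l, G.IsPathList l → l.length ≤ L) (hK : G.IsClique K)
    (hB : ∀ R, G.IsPathOfCard L R → ∀ s ∈ K, ∀ r ∈ K, r ≠ s → (∀ a ∈ R, a ∈ K → a = s) →
      ∃ e ∈ R, e ∉ K ∧ G.Touches K e r)
    (hno : ∀ e, e ∉ K → G.Touches K e z → G.Touches K e w →
      ¬ G.Touches K e x ∨ ¬ G.Touches K e y)
    (hzK : z ∈ K) (hyK : y ∈ K) (hwK : w ∈ K)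
    (hxy : x ≠ y) (hxw : x ≠ w) (hzy : z ≠ y) (hzw : z ≠ w) (hyw : y ≠ w)
    (hP : G.IsPathOfCard L P) (hPK : ∀ a ∈ P, a ∈ K → a = x ∨ a = z)
    (hPz : ∀ a ∈ P, a ∉ K → G.Touches K a z)
    (hQ : G.IsPathOfCard L Q) (hQK : ∀ a ∈ Q, a ∈ K → a = y ∨ a = w)
    (hQw : ∀ a ∈ Q, a ∉ K → G.Touches K a w)
    (hcP : c ∈ P) (hcQ : c ∈ Q) (hcK : c ∉ K) (hcy : ¬ G.Touches K c y) :
    G.HasLongTail L K c := by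
  have hPQ : ∀ a ∈ P, a ∈ Q → a ∉ K := by
    intro a haP haQ haK
    rcases hPK a haP haK with rfl | rfl <;> rcases hQK _ haQ haK with h | h <;> tauto
  have hwP : w ∉ P := fun h => by rcases hPK w h hwK with h | h <;> tauto
  have hzQ : z ∉ Q := fun h => by rcases hQK z h hzK with h | h <;> tauto
  have hcc := self_mem_complComp (G := G) K c
  have hwQ : w ∈ Q := by
    by_contra hwQ
    have hs := hQ.1.subset_complComp_of_not_touches hcK (y := y) (fun a ha haK => by
      rcases hQK a ha haK with h | h
      · exact h
      · exact absurd (h ▸ ha) hwQ) hcQ hcc hcy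
    obtain ⟨e, he, heK, het⟩ := hB Q hQ w hwK y hyK hyw
      (fun a ha haK => absurd haK (notMem_of_mem_complComp hcK (hs a ha)))
    exact hcy (het.of_mem (hs e he))
  obtain ⟨Q1, B, hQ1, hBp, hd, hlen, hcB, hmQ⟩ :=
    hQ.1.exists_split_of_mem hwQ hcQ (fun h => hcK (h ▸ hwK))
  have hQ1Q : ∀ a ∈ Q1, a ∈ Q := fun a ha => (hmQ a).2 (by tauto)
  have hBQ : ∀ a ∈ B, a ∈ Q := fun a ha => (hmQ a).2 (by tauto)
  have hQ1K : ∀ a ∈ Q1, a ∈ K → a = y := fun a ha haK => by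
    rcases hQK a (hQ1Q a ha) haK with h | h
    · exact h
    · exact absurd (h ▸ ha) hQ1.notMem_of_cons
  have hBK : ∀ a ∈ B, a ∈ K → a = y := fun a ha haK => by
    rcases hQK a (hBQ a ha) haK with h | h
    · exact h
    · exact absurd (h ▸ ha) hBp.notMem_of_cons
  have hBT := hBp.tail.subset_complComp_of_not_touches hcK hBK hcB hcc hcy
  -- the rest of `Q` cannot stay in a single component that is not touched by `y`
  have hesc : ∀ e, e ∉ K → ¬ G.Touches K e y → ∀ u ∈ Q1, u ∈ G.complComp K e → False := by
    intro e he hey u hu hu'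
    have hs := hQ1.tail.subset_complComp_of_not_touches he hQ1K hu hu' hey
    obtain ⟨f, hf, hfK, hft⟩ := hB Q hQ w hwK y hyK hyw (fun a ha haK => by
      rcases (hmQ a).1 ha with h | h | h
      · exact h
      · exact absurd haK (notMem_of_mem_complComp he (hs a h))
      · exact absurd haK (notMem_of_mem_complComp hcK (hBT a h)))
    rcases (hmQ f).1 hf with h | h | h
    · exact hfK (h ▸ hwK)
    · exact hey (hft.of_mem (hs f h))
    · exact hcy (hft.of_mem (hBT f h))
  have hQ1T : ∀ u ∈ Q1, u ∉ G.complComp K c := fun u hu hu' => hesc c hcK hcy u hu hu'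
  have hPl := hP.2
  have hQl := hQ.2
  -- If `Q1` misses `P`, joining it to the longer half `D` of `P` gives `|Q1| + |D| + 2 ≤ L`. With
  -- `|Q1| + |B| + 1 = L` and `2|D| ≥ L - 1` this is `2|B| ≥ L + 1`.
  by_cases hQ1P : ∀ a ∈ Q1, a ∉ P
  · have hPm : ∃ k ∈ P, k ∈ K := by
      by_contra! hcon
      have hs := hP.1.subset_complComp hcK hcP hcc hcon
      obtain ⟨e, he, heK, het⟩ := hB P hP w hwK y hyK hyw
        (fun a ha haK => absurd haK (hcon a ha))
      exact hcy (het.of_mem (hs e he))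
    obtain ⟨k, hkP, hkK⟩ := hPm
    obtain ⟨A, D, -, hD, -, hAD, hle, hmP⟩ := hP.1.exists_split hkP
    have hwk : w ≠ k := fun h => hwP (h ▸ hkP)
    have := add_length_le_of_adj hL hQ1 hD (hK hwK hkK hwk) (by
      intro a ha ha'
      have haP : a ∈ P := by
        rcases List.mem_cons.1 ha' with h | h
        · exact h ▸ hkP
        · exact (hmP a).2 (by tauto)
      rcases List.mem_cons.1 ha with h | h
      · exact hwP (h ▸ haP)
      · exact hQ1P a h haP)
    exact ⟨w, hwK, B, hBp, hBT, by omega⟩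
  · exfalso
    push Not at hQ1P
    obtain ⟨c', hc'Q1, hc'P⟩ := hQ1P
    have hc'c' := self_mem_complComp (G := G) K c'
    have hc'K := hPQ c' hc'P (hQ1Q c' hc'Q1)
    have key : ∀ e ∈ P, e ∈ Q1 → ¬ G.Touches K e x := by
      intro e heP heQ
      have heK := hPQ e heP (hQ1Q e heQ)
      rcases hno e heK (hPz e heP heK) (hQw e (hQ1Q e heQ) heK) with h | h
      · exact h
      · exact absurd (self_mem_complComp K e) (fun h' => hesc e heK h e heQ h')
    have hc'x := key c' hc'P hc'Q1
    have hc'T : c' ∉ G.complComp K c := hQ1T c' hc'Q1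
    have hcT' : c ∉ G.complComp K c' := fun h => hc'T (by
      rw [complComp_eq_of_mem h]; exact hc'c')
    have hzP : z ∈ P := by
      by_contra hzP
      exact hcT' (hP.1.subset_complComp_of_not_touches hc'K (y := x) (fun a ha haK => by
        rcases hPK a ha haK with h | h
        · exact h
        · exact absurd (h ▸ ha) hzP) hc'P hc'c' hc'x c hcP)
    obtain ⟨P1, D, hP1, hD, hdP, hlenP, hc'D, hmP⟩ :=
      hP.1.exists_split_of_mem hzP hc'P (fun h => hc'K (h ▸ hzK))
    have hP1P : ∀ a ∈ P1, a ∈ P := fun a ha => (hmP a).2 (by tauto)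
    have hDP : ∀ a ∈ D, a ∈ P := fun a ha => (hmP a).2 (by tauto)
    have hP1K : ∀ a ∈ P1, a ∈ K → a = x := fun a ha haK => by
      rcases hPK a (hP1P a ha) haK with h | h
      · exact h
      · exact absurd (h ▸ ha) hP1.notMem_of_cons
    have hDK : ∀ a ∈ D, a ∈ K → a = x := fun a ha haK => by
      rcases hPK a (hDP a ha) haK with h | h
      · exact h
      · exact absurd (h ▸ ha) hD.notMem_of_cons
    have hDT := hD.tail.subset_complComp_of_not_touches hc'K hDK hc'D hc'c' hc'x
    have hcP1 : c ∈ P1 := by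
      rcases (hmP c).1 hcP with h | h | h
      · exact absurd (h ▸ hzK) hcK
      · exact h
      · exact absurd (hDT c h) hcT'
    have hdisj : ∀ a ∈ Q1, a ∉ P1 := by
      intro e heQ heP
      have heK := hPQ e (hP1P e heP) (hQ1Q e heQ)
      have hs := hP1.tail.subset_complComp_of_not_touches heK hP1K heP
        (self_mem_complComp K e) (key e (hP1P e heP) heQ) c hcP1
      refine hQ1T e heQ ?_
      rw [complComp_eq_of_mem hs]
      exact self_mem_complComp K e
    -- Recombining the halves of `P` at `z` and of `Q` at `w`, as `Q1` with `P1` and `B` with `D`,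
    -- gives two paths with `2L + 2` vertices in total.
    have h1 := add_length_le_of_adj hL hQ1 hP1 (hK hwK hzK hzw.symm) (by
      intro a ha ha'
      rcases List.mem_cons.1 ha with h | h <;> rcases List.mem_cons.1 ha' with h' | h'
      · exact hzw (h'.symm.trans h)
      · exact hwP (h ▸ hP1P a h')
      · exact hzQ (h' ▸ hQ1Q a h)
      · exact hdisj a h h')
    have h2 := add_length_le_of_adj hL hBp hD (hK hwK hzK hzw.symm) (by
      intro a ha ha'
      rcases List.mem_cons.1 ha with h | h <;> rcases List.mem_cons.1 ha' with h' | h'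
      · exact hzw (h'.symm.trans h)
      · exact hwP (h ▸ hDP a h')
      · exact hzQ (h' ▸ hBQ a h)
      · apply hc'T
        rw [← complComp_eq_of_mem (hBT a h), complComp_eq_of_mem (hDT a h')]
        exact hc'c')
    omega

/-- Two components with long tails coincide. -/
theorem HasLongTail.unique {K : Set V} (hL : ∀ l, G.IsPathList l → l.length ≤ L)
    (hK : G.IsClique K) {c d : V} (hcK : c ∉ K) (hdK : d ∉ K) (hc : G.HasLongTail L K c)
    (hd : G.HasLongTail L K d) : d ∈ G.complComp K c := by
  obtain ⟨k, hk, A, hA, hAc, hAl⟩ := hc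
  obtain ⟨m, hm, B, hB, hBd, hBl⟩ := hd
  by_contra hcon
  have hdisj : ∀ a ∈ A, a ∉ B := by
    intro a ha hb
    apply hcon
    rw [← complComp_eq_of_mem (hAc a ha), complComp_eq_of_mem (hBd a hb)]
    exact self_mem_complComp K d
  have hAK : ∀ a ∈ A, a ∉ K := fun a ha => notMem_of_mem_complComp hcK (hAc a ha)
  have hBK : ∀ a ∈ B, a ∉ K := fun a ha => notMem_of_mem_complComp hdK (hBd a ha)
  by_cases hkm : k = m
  · subst hkm
    cases B with
    | nil => simp at hBl
    | cons b B =>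
      have hkb : G.Adj k b := by
        have := hB.2; rw [List.isChain_cons_cons] at this; exact this.1
      have := add_length_le_of_adj hL hA hB.tail hkb (by
        intro a ha ha'
        rcases List.mem_cons.1 ha with h | h
        · exact hBK a ha' (h ▸ hk)
        · exact hdisj a h ha')
      simp at hBl
      omega
  · have := add_length_le_of_adj hL hA hB (hK hk hm hkm) (by
      intro a ha ha'
      rcases List.mem_cons.1 ha with h | h <;> rcases List.mem_cons.1 ha' with h' | h'
      · exact hkm (h.symm.trans h')
      · exact hBK a h' (h ▸ hk)
      · exact hAK a h (h' ▸ hm)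
      · exact hdisj a h h')
    omega

/-- Two arrows without common end give a component with a long tail touching both heads. -/
theorem HasArrow.exists_hasLongTail {K : Set V} {x z y w : V}
    (hL : ∀ l, G.IsPathList l → l.length ≤ L)
    (hint : ∀ P Q, G.IsPathOfCard L P → G.IsPathOfCard L Q → ∃ c ∈ P, c ∈ Q)
    (hK : G.IsClique K)
    (hB : ∀ R, G.IsPathOfCard L R → ∀ s ∈ K, ∀ r ∈ K, r ≠ s → (∀ a ∈ R, a ∈ K → a = s) →
      ∃ e ∈ R, e ∉ K ∧ G.Touches K e r)
    (hno : ∀ e, e ∉ K → G.Touches K e z → G.Touches K e w →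
      ¬ G.Touches K e x ∨ ¬ G.Touches K e y)
    (hxK : x ∈ K) (hzK : z ∈ K) (hyK : y ∈ K) (hwK : w ∈ K) (hxz : x ≠ z)
    (hxy : x ≠ y) (hxw : x ≠ w) (hzy : z ≠ y) (hzw : z ≠ w) (hyw : y ≠ w)
    (h1 : G.HasArrow L K x z) (h2 : G.HasArrow L K y w) :
    ∃ c, c ∉ K ∧ G.Touches K c z ∧ G.Touches K c w ∧ G.HasLongTail L K c := by
  obtain ⟨P, hP, hPK, hPz⟩ := h1
  obtain ⟨Q, hQ, hQK, hQw⟩ := h2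
  obtain ⟨c, hcP, hcQ⟩ := hint P Q hP hQ
  have hcK : c ∉ K := by
    intro haK
    rcases hPK c hcP haK with rfl | rfl <;> rcases hQK _ hcQ haK with h | h <;> tauto
  refine ⟨c, hcK, hPz c hcP hcK, hQw c hcQ hcK, ?_⟩
  rcases hno c hcK (hPz c hcP hcK) (hQw c hcQ hcK) with h | h
  · exact hasLongTail_of_not_touches hL hK hB (fun e he h1 h2 => (hno e he h2 h1).symm)
      hwK hxK hzK hxy.symm hzy.symm hxw.symm hzw.symm hxz hQ hQK hQw hP hPK hPz hcQ hcP hcK h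
  · exact hasLongTail_of_not_touches hL hK hB hno
      hzK hyK hwK hxy hxw hzy hzw hyw hP hPK hPz hQ hQK hQw hcP hcQ hcK h

/-- If every vertex of the 4-clique `K` is the head of at least two arrows, some component of
`G - K` is touched by all of `K`. -/
theorem exists_forall_touches_of_hasArrow [DecidableEq V] {K : Finset V}
    (hL : ∀ l, G.IsPathList l → l.length ≤ L)
    (hint : ∀ P Q, G.IsPathOfCard L P → G.IsPathOfCard L Q → ∃ c ∈ P, c ∈ Q)
    (hK : G.IsClique (K : Set V)) (hK4 : K.card = 4)
    (harr : ∀ z ∈ K, ∃ x ∈ K, ∃ y ∈ K, x ≠ y ∧ x ≠ z ∧ y ≠ z ∧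
      G.HasArrow L K x z ∧ G.HasArrow L K y z) :
    ∃ c ∉ K, ∀ r ∈ K, G.Touches K c r := by
  by_contra! hcon
  have hB : ∀ R, G.IsPathOfCard L R → ∀ s ∈ (K : Set V), ∀ r ∈ (K : Set V), r ≠ s →
      (∀ a ∈ R, a ∈ (K : Set V) → a = s) → ∃ e ∈ R, e ∉ (K : Set V) ∧ G.Touches K e r := by
    intro R hR s hs r hr hrs hRs
    -- Of the two arrows into `r`, at least one does not start at `s`.
    obtain ⟨x, hx, y, hy, hxy, hxz, hyz, h1, h2⟩ := harr r hr
    by_cases hxs : x = s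
    · exact exists_touches_of_hasArrow hint hR hRs hrs (fun h => hxy (hxs.trans h.symm)) h2
    · exact exists_touches_of_hasArrow hint hR hRs hrs hxs h1
  have hlt : ∀ z ∈ K, ∃ c, c ∉ (K : Set V) ∧ G.Touches K c z ∧ G.HasLongTail L K c := by
    intro z hz
    obtain ⟨x, hx, y, hy, hxy, hxz, hyz, h1, h2⟩ := harr z hz
    obtain ⟨w, hw⟩ : ∃ w, w ∈ K \ {x, y, z} := by
      apply Finset.card_pos.1
      have := Finset.le_card_sdiff ({x, y, z} : Finset V) K
      have h3 := Finset.card_le_three (a := x) (b := y) (c := z)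
      omega
    simp only [Finset.mem_sdiff, Finset.mem_insert, Finset.mem_singleton, not_or] at hw
    obtain ⟨hwK, hwx, hwy, hwz⟩ := hw
    have hKe : K = {x, y, z, w} := by
      symm
      apply Finset.eq_of_subset_of_card_le
      · intro a ha
        simp at ha
        rcases ha with rfl | rfl | rfl | rfl <;> assumption
      · rw [hK4, Finset.card_insert_of_notMem, Finset.card_insert_of_notMem,
          Finset.card_insert_of_notMem, Finset.card_singleton]
        · simp [Ne.symm hwz]
        · simp [Ne.symm hwy, hyz]
        · simp [Ne.symm hwx, hxy, hxz]
    obtain ⟨a, ha, b, hb, hab, haw, hbw, h3, h4⟩ := harr w hwK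
    have hno : ∀ e, e ∉ (K : Set V) → G.Touches K e z → G.Touches K e w →
        ¬ G.Touches K e x ∨ ¬ G.Touches K e y := by
      intro e he hez hew
      obtain ⟨r, hr, hr'⟩ := hcon e he
      rw [hKe] at hr
      simp only [Finset.mem_insert, Finset.mem_singleton] at hr
      rcases hr with rfl | rfl | rfl | rfl <;> tauto
    -- Two of the three vertices other than `w` send arrows to `w`, so `z` is not the only one. This
    -- produces two arrows without a common end.
    have hyw : G.HasArrow L K y w ∨ G.HasArrow L K x w := by
      rw [hKe] at ha hb
      simp only [Finset.mem_insert, Finset.mem_singleton] at ha hb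
      rcases ha with rfl | rfl | rfl | rfl <;> rcases hb with rfl | rfl | rfl | rfl <;> tauto
    rcases hyw with h | h
    · obtain ⟨c, hc, hcz, -, hcl⟩ := h1.exists_hasLongTail hL hint hK hB hno hx hz hy hwK hxz
        hxy (Ne.symm hwx) (Ne.symm hyz) (Ne.symm hwz) (Ne.symm hwy) h
      exact ⟨c, hc, hcz, hcl⟩
    · obtain ⟨c, hc, hcz, -, hcl⟩ := h2.exists_hasLongTail hL hint hK hB
        (fun e he h h' => (hno e he h h').symm) hy hz hx hwK hyz
        (Ne.symm hxy) (Ne.symm hwy) (Ne.symm hxz) (Ne.symm hwz) (Ne.symm hwx) h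
      exact ⟨c, hc, hcz, hcl⟩
  -- Every vertex of `K` touches a component with a long tail, and there is only one such component.
  obtain ⟨z, hz⟩ : ∃ z, z ∈ K := Finset.card_pos.1 (by omega)
  obtain ⟨c, hc, -, hcl⟩ := hlt z hz
  obtain ⟨r, hr, hr'⟩ := hcon c hc
  obtain ⟨d, hd, hdr, hdl⟩ := hlt r hr
  exact hr' (hdr.of_mem (hcl.unique hL hK hc hd hdl))

/-! ### Captured components and the descent -/

/-- Whenever `S` is a clique, every component of `G - S` has a vertex adjacent to all those
vertices of `S` that touch the component. -/
def HasCones (G : SimpleGraph V) : Prop :=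
  ∀ S : Finset V, G.IsClique (S : Set V) → ∀ c ∉ S,
    ∃ v ∈ G.complComp S c, ∀ s ∈ S, G.Touches S c s → G.Adj s v

/-- Some longest path lies in the component of `c` in `G - S`, except possibly for `s`. -/
def IsNear (G : SimpleGraph V) (L : ℕ) (S : Set V) (c s : V) : Prop :=
  ∃ P, G.IsPathOfCard L P ∧ ∀ a ∈ P, a ∈ G.complComp S c ∨ a = s

/-- The component of `c` in `G - S` contains a longest path or, if `S` has three vertices,
contains longest paths up to one vertex `s` of `S`, for two choices of `s`. -/
def Captures (G : SimpleGraph V) (L : ℕ) (S : Finset V) (c : V) : Prop :=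
  (∃ P, G.IsPathOfCard L P ∧ ∀ a ∈ P, a ∈ G.complComp S c) ∨
    (S.card = 3 ∧ ∃ s ∈ S, ∃ t ∈ S, s ≠ t ∧ G.IsNear L S c s ∧ G.IsNear L S c t)

/-- A path with at least two vertices that runs through `s` contains a neighbour of `s`, which would
lie in the component. -/
theorem IsNear.exists_of_not_touches {S : Set V} {c s : V} (hL2 : 2 ≤ L) (h : G.IsNear L S c s)
    (hs : ¬ G.Touches S c s) : ∃ P, G.IsPathOfCard L P ∧ ∀ a ∈ P, a ∈ G.complComp S c := by
  obtain ⟨P, hP, hPs⟩ := h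
  refine ⟨P, hP, ?_⟩
  by_cases hsP : s ∈ P
  · exfalso
    obtain ⟨A, B, -, hB, -, hl, hle, hm⟩ := hP.1.exists_split hsP
    have := hP.2
    cases B with
    | nil => simp at hle hl; simp [hle] at hl; omega
    | cons b B =>
      have hsb : G.Adj s b := by
        have := hB.2; rw [List.isChain_cons_cons] at this; exact this.1
      rcases hPs b ((hm b).2 (by simp)) with h | h
      · exact hs ⟨b, h, hsb⟩
      · exact hsb.ne h.symm
  · intro a ha
    rcases hPs a ha with h | h
    · exact h
    · exact absurd (h ▸ ha) hsP

/-- If no longest path avoids `S`, then avoiding two vertices of `S` leaves a longest path meeting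
`S` in the third vertex `s` alone. Cut it at `s` into a shorter half `A s` and a longer half `B s`.
The longer halves all lie in one component, and an exchange shows that at most one shorter half
leaves it. -/
theorem exists_captures_of_card_eq_three [DecidableEq V] {S : Finset V}
    (hL : ∀ l, G.IsPathList l → l.length ≤ L) (hL2 : 2 ≤ L)
    (hav : ∀ a b, ∃ P, G.IsPathOfCard L P ∧ a ∉ P ∧ b ∉ P)
    (hS : G.IsClique (S : Set V)) (hS3 : S.card = 3) : ∃ c ∉ S, G.Captures L S c := by
  by_cases hex : ∃ P, G.IsPathOfCard L P ∧ ∀ a ∈ P, a ∉ (S : Set V)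
  · obtain ⟨P, hP, hPS⟩ := hex
    obtain ⟨c, hc⟩ : ∃ c, c ∈ P := List.exists_mem_of_length_pos (by have := hP.2; omega)
    exact ⟨c, hPS c hc, Or.inl ⟨P, hP,
      hP.1.subset_complComp (hPS c hc) hc (self_mem_complComp _ _) hPS⟩⟩
  have hsplit : ∀ s ∈ S, ∃ A B, G.IsPathList (s :: A) ∧ G.IsPathList (s :: B) ∧
      (∀ a ∈ A, a ∉ (S : Set V)) ∧ (∀ a ∈ B, a ∉ (S : Set V)) ∧ L = A.length + B.length + 1 ∧
      A.length ≤ B.length ∧ ∃ P, G.IsPathOfCard L P ∧ ∀ a, a ∈ P ↔ a = s ∨ a ∈ A ∨ a ∈ B := by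
    intro s hs
    have h2 : (S.erase s).card = 2 := by rw [Finset.card_erase_of_mem hs]; omega
    obtain ⟨x, y, -, hxy⟩ := Finset.card_eq_two.1 h2
    obtain ⟨P, hP, hx, hy⟩ := hav x y
    have hPS : ∀ a ∈ P, a ∈ (S : Set V) → a = s := by
      intro a ha haS
      by_contra has
      have : a ∈ S.erase s := Finset.mem_erase.2 ⟨has, haS⟩
      rw [hxy] at this
      simp at this
      rcases this with rfl | rfl <;> contradiction
    have hsP : s ∈ P := by
      by_contra hsP
      exact hex ⟨P, hP, fun a ha haS => hsP (hPS a ha haS ▸ ha)⟩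
    obtain ⟨A, B, hA, hB, hd, hl, hle, hm⟩ := hP.1.exists_split hsP
    refine ⟨A, B, hA, hB, ?_, ?_, by rw [← hl, hP.2], hle, P, hP, hm⟩
    · intro a ha haS
      have := hPS a ((hm a).2 (by tauto)) haS
      exact hA.notMem_of_cons (this ▸ ha)
    · intro a ha haS
      have := hPS a ((hm a).2 (by tauto)) haS
      exact hB.notMem_of_cons (this ▸ ha)
  choose! A B hA hB hAS hBS hlen hle hP using hsplit
  -- Disjoint longer halves, each with at least `(L - 1) / 2` vertices besides `s` and `t`, would
  -- join to a path with more than `L` vertices.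
  have hmeet : ∀ s ∈ S, ∀ t ∈ S, s ≠ t → ∃ c ∈ B s, c ∈ B t := by
    intro s hs t ht hst
    by_contra! hcon
    have := add_length_le_of_adj hL (hB s hs) (hB t ht) (hS hs ht hst) (by
      intro a ha ha'
      rcases List.mem_cons.1 ha with h | h <;> rcases List.mem_cons.1 ha' with h' | h'
      · exact hst (h.symm.trans h')
      · exact hBS t ht a h' (h ▸ hs)
      · exact hBS s hs a h (h' ▸ ht)
      · exact hcon a h h')
    have h1 := hlen s hs
    have h2 := hlen t ht
    have h3 := hle s hs
    have h4 := hle t ht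
    omega
  obtain ⟨x, y, z, hxy, hxz, hyz, hSe⟩ := Finset.card_eq_three.1 hS3
  have hx : x ∈ S := by simp [hSe]
  have hy : y ∈ S := by simp [hSe]
  have hz : z ∈ S := by simp [hSe]
  obtain ⟨c, hcx, hcy⟩ := hmeet x hx y hy hxy
  have hc : c ∉ (S : Set V) := hBS x hx c hcx
  have hBC : ∀ s ∈ S, ∀ a ∈ B s, a ∈ G.complComp S c := by
    intro s hs
    have hxC := (hB x hx).tail.subset_complComp hc hcx (self_mem_complComp _ _) (hBS x hx)
    by_cases hsx : s = x
    · rw [hsx]; exact hxC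
    · obtain ⟨d, hds, hdx⟩ := hmeet s hs x hx hsx
      exact (hB s hs).tail.subset_complComp hc hds (hxC d hdx) (hBS s hs)
  have hnear : ∀ s ∈ S, (∀ a ∈ A s, a ∈ G.complComp S c) → G.IsNear L S c s := by
    intro s hs h
    obtain ⟨P, hP1, hP2⟩ := hP s hs
    refine ⟨P, hP1, fun a ha => ?_⟩
    rcases (hP2 a).1 ha with h' | h' | h'
    · exact Or.inr h'
    · exact Or.inl (h a h')
    · exact Or.inl (hBC s hs a h')
  -- If both shorter halves avoid the component, joining `A s` with `B t` and `A t` with `B s` gives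
  -- `2L + 2` vertices on two paths.
  have hpair : ∀ s ∈ S, ∀ t ∈ S, s ≠ t → G.IsNear L S c s ∨ G.IsNear L S c t := by
    intro s hs t ht hst
    by_contra! hcon
    have hout : ∀ s ∈ S, ¬ G.IsNear L S c s → ∀ a ∈ A s, a ∉ G.complComp S c :=
      fun s hs hn a ha haC => hn (hnear s hs
        ((hA s hs).tail.subset_complComp hc ha haC (hAS s hs)))
    have key : ∀ s ∈ S, ∀ t ∈ S, s ≠ t → ¬ G.IsNear L S c s →
        (A s).length + (B t).length + 2 ≤ L := by
      intro s hs t ht hst hn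
      refine add_length_le_of_adj hL (hA s hs) (hB t ht) (hS hs ht hst) ?_
      intro a ha ha'
      rcases List.mem_cons.1 ha with h | h <;> rcases List.mem_cons.1 ha' with h' | h'
      · exact hst (h.symm.trans h')
      · exact hBS t ht a h' (h ▸ hs)
      · exact hAS s hs a h (h' ▸ ht)
      · exact hout s hs hn a h (hBC t ht a h')
    have h1 := key s hs t ht hst hcon.1
    have h2 := key t ht s hs hst.symm hcon.2
    have h3 := hlen s hs
    have h4 := hlen t ht
    omega
  refine ⟨c, hc, Or.inr ⟨hS3, ?_⟩⟩
  rcases hpair x hx y hy hxy with h | h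
  · rcases hpair y hy z hz hyz with h' | h'
    · exact ⟨x, hx, y, hy, hxy, h, h'⟩
    · exact ⟨x, hx, z, hz, hxz, h, h'⟩
  · rcases hpair x hx z hz hxz with h' | h'
    · exact ⟨y, hy, x, hx, hxy.symm, h, h'⟩
    · exact ⟨y, hy, z, hz, hyz, h, h'⟩

theorem exists_isPathOfCard_disjoint {S : Finset V}
    (hav : ∀ a b, ∃ P, G.IsPathOfCard L P ∧ a ∉ P ∧ b ∉ P) [Nonempty V]
    (hS2 : S.card ≤ 2) : ∃ P, G.IsPathOfCard L P ∧ ∀ a ∈ P, a ∉ (S : Set V) := by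
  classical
  obtain ⟨x, y, hxy⟩ : ∃ x y, S ⊆ {x, y} := by
    rcases S.eq_empty_or_nonempty with rfl | ⟨x, hx⟩
    · exact ⟨Classical.arbitrary V, Classical.arbitrary V, by simp⟩
    · have h1 : (S.erase x).card ≤ 1 := by rw [Finset.card_erase_of_mem hx]; omega
      rcases Finset.card_le_one_iff_subset_singleton.1 h1 with ⟨y, hy⟩
      exact ⟨x, y, by rw [← Finset.insert_erase hx]; exact Finset.insert_subset_insert _ hy⟩
  obtain ⟨P, hP, hx, hy⟩ := hav x y
  refine ⟨P, hP, fun a ha haS => ?_⟩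
  have := hxy haS
  simp at this
  rcases this with rfl | rfl <;> contradiction

theorem exists_captures [DecidableEq V] [Nonempty V] {S : Finset V}
    (hL : ∀ l, G.IsPathList l → l.length ≤ L) (hL2 : 2 ≤ L)
    (hav : ∀ a b, ∃ P, G.IsPathOfCard L P ∧ a ∉ P ∧ b ∉ P)
    (hS : G.IsClique (S : Set V)) (hS3 : S.card ≤ 3) : ∃ c ∉ S, G.Captures L S c := by
  rcases Nat.lt_or_eq_of_le hS3 with h | h
  · obtain ⟨P, hP, hPS⟩ := exists_isPathOfCard_disjoint hav (Nat.le_of_lt_succ h)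
    obtain ⟨c, hc⟩ : ∃ c, c ∈ P := List.exists_mem_of_length_pos (by have := hP.2; omega)
    exact ⟨c, hPS c hc, Or.inl ⟨P, hP,
      hP.1.subset_complComp (hPS c hc) hc (self_mem_complComp _ _) hPS⟩⟩
  · exact exists_captures_of_card_eq_three hL hL2 hav hS h

/-- The separator of a captured component may be shrunk to the vertices touching it. -/
theorem Captures.exists_subset [Nonempty V] {S : Finset V} {c : V} (hL2 : 2 ≤ L)
    (hint : ∀ P Q, G.IsPathOfCard L P → G.IsPathOfCard L Q → ∃ c ∈ P, c ∈ Q)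
    (hav : ∀ a b, ∃ P, G.IsPathOfCard L P ∧ a ∉ P ∧ b ∉ P) (hc : c ∉ S) (hS3 : S.card ≤ 3)
    (h : G.Captures L S c) :
    ∃ N ⊆ S, G.complComp N c = G.complComp S c ∧ G.Captures L N c ∧ ∀ s ∈ N, G.Touches N c s := by
  classical
  let N := S.filter fun s => G.Touches S c s
  have hNS : N ⊆ S := Finset.filter_subset _ _
  have hNS' : (N : Set V) ⊆ S := Finset.coe_subset.2 hNS
  have hcomp : G.complComp N c = G.complComp S c := by
    refine Set.Subset.antisymm ?_ (complComp_anti hNS' c)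
    intro u hu
    induction hu with
    | refl => exact self_mem_complComp _ _
    | @tail a b _ hab ih =>
      refine mem_complComp_of_adj hc ih hab.1 fun hbS => hab.2.2 ?_
      exact Finset.mem_coe.2 (Finset.mem_filter.2 ⟨hbS, a, ih, hab.1.symm⟩)
  have htouch : ∀ s ∈ N, G.Touches N c s := fun s hs => by
    obtain ⟨u, hu, hsu⟩ := (Finset.mem_filter.1 hs).2
    exact ⟨u, by rwa [hcomp], hsu⟩
  refine ⟨N, hNS, hcomp, ?_, htouch⟩
  by_cases hNe : N = S
  · rw [hNe]; exact h
  have hlt : N.card < S.card := Finset.card_lt_card (hNS.ssubset_of_ne hNe)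
  left
  rw [hcomp]
  rcases h with h | ⟨-, s, hs, -, -, -, hn, -⟩
  · exact h
  by_cases hsN : G.Touches S c s
  · have hsN' : s ∈ N := Finset.mem_filter.2 ⟨hs, hsN⟩
    -- `N` is a proper subset of `S`, so its at most two vertices can be avoided. This path meets
    -- `Q`, not in `s`, hence inside the component, and cannot leave it.
    obtain ⟨P, hP, hPN⟩ := exists_isPathOfCard_disjoint (S := N) hav (by omega)
    obtain ⟨Q, hQ, hQs⟩ := hn
    obtain ⟨e, heP, heQ⟩ := hint P Q hP hQ
    refine ⟨P, hP, ?_⟩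
    rw [← hcomp]
    refine hP.1.subset_complComp (fun h => hc (hNS h)) heP ?_ hPN
    rcases hQs e heQ with h | h
    · rwa [hcomp]
    · exact absurd hsN' (h ▸ hPN e heP)
  · exact hn.exists_of_not_touches hL2 hsN

/-- Deleting `r` from its component of `G - S` leaves pieces that all touch `r`. This turns a
longest path near the component of `r` in `G - (K \ {r})` into an arrow with head `r`. -/
theorem touches_insert_of_mem_complComp {S : Set V} {r a : V}
    (ha : a ∈ G.complComp S r) (har : a ≠ r) : G.Touches (insert r S) a r := by
  induction ha with
  | refl => exact absurd rfl har
  | @tail b a _ hba ih =>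
    by_cases hbr : b = r
    · exact ⟨a, self_mem_complComp _ _, hbr ▸ hba.1⟩
    · refine (ih hbr).of_mem (Relation.ReflTransGen.single ⟨hba.1.symm, ?_, ?_⟩)
      · simp [har, hba.2.2]
      · simp [hbr, hba.2.1]

/-- Infinite descent on the size of the captured component. Adding a cone `v` to the separator gives
a clique `K`. A component captured by a small subset of `K` and avoiding `K` is either strictly
inside the present one, because it misses `v`, or disjoint from it. Disjointness contradicts the
fact that longest paths meet. -/
theorem false_of_captures [Finite V] [DecidableEq V] [Nonempty V]
    (hL : ∀ l, G.IsPathList l → l.length ≤ L) (hL2 : 2 ≤ L)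
    (hint : ∀ P Q, G.IsPathOfCard L P → G.IsPathOfCard L Q → ∃ c ∈ P, c ∈ Q)
    (hav : ∀ a b, ∃ P, G.IsPathOfCard L P ∧ a ∉ P ∧ b ∉ P)
    (hcone : G.HasCones) (h5 : G.CliqueFree 5) (n : ℕ) :
    ∀ (S : Finset V) (c : V), G.IsClique (S : Set V) → S.card ≤ 3 → c ∉ S → G.Captures L S c →
      (G.complComp S c).ncard = n → False := by
  induction n using Nat.strong_induction_on with
  | _ n ih =>
  intro S₀ c hS₀ hS₀3 hcS₀ hcap₀ hn₀
  obtain ⟨S, hSS₀, hcomp, hcap, htouch⟩ := hcap₀.exists_subset hL2 hint hav hcS₀ hS₀3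
  have hS : G.IsClique (S : Set V) := hS₀.subset (Finset.coe_subset.2 hSS₀)
  have hS3 : S.card ≤ 3 := (Finset.card_le_card hSS₀).trans hS₀3
  have hcS : c ∉ (S : Set V) := fun h => hcS₀ (hSS₀ h)
  have hn : (G.complComp S c).ncard = n := by rw [hcomp, hn₀]
  clear hcap₀ hn₀ hcomp hS₀ hS₀3 hcS₀ hSS₀
  obtain ⟨v, hvC, hvadj⟩ := hcone S hS c hcS
  have hvS : v ∉ S := notMem_of_mem_complComp hcS hvC
  have hvS' : ∀ s ∈ S, G.Adj s v := fun s hs => hvadj s hs (htouch s hs)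
  set K := insert v S with hKdef
  have hK : G.IsClique (K : Set V) := by
    rw [hKdef, Finset.coe_insert]
    exact hS.insert fun s hs _ => (hvS' s hs).symm
  -- a captured component that avoids `K` is not contained in the current one
  have hsub : ∀ (T : Finset V) (d : V), T ⊆ K → T.card ≤ 3 → d ∉ T → G.Captures L T d →
      (∀ a ∈ G.complComp T d, a ∉ K) → ∀ a ∈ G.complComp T d, a ∉ G.complComp S c := by
    intro T d hTK hT3 hdT hTd hav' a ha haC
    have hss : G.complComp T d ⊆ G.complComp S c :=
      complComp_subset_of_disjoint hdT
        (fun w hw hwS => hav' w hw (Finset.mem_insert_of_mem hwS)) ha haC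
    have hlt : (G.complComp T d).ncard < n := by
      rw [← hn]
      refine Set.ncard_lt_ncard ⟨hss, fun h => ?_⟩ (Set.toFinite _)
      exact hav' v (h hvC) (Finset.mem_insert_self _ _)
    exact ih _ hlt T d (hK.subset (Finset.coe_subset.2 hTK)) hT3 hdT hTd rfl
  rcases Nat.lt_or_eq_of_le hS3 with hlt | hS3
  · obtain ⟨P, hP, hPC⟩ : ∃ P, G.IsPathOfCard L P ∧ ∀ a ∈ P, a ∈ G.complComp S c := by
      rcases hcap with h | h
      · exact h
      · omega
    have hKc : K.card ≤ 3 := by rw [hKdef, Finset.card_insert_of_notMem hvS]; omega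
    -- The new component is disjoint from the old one, which contains all of `P`. Only `v` could
    -- serve as an extra vertex where a nearly contained longest path meets `P`, but capture offers
    -- two extra vertices.
    obtain ⟨d, hd, hdcap⟩ := exists_captures hL hL2 hav hK hKc
    have hdis := hsub K d subset_rfl hKc hd hdcap
      (fun a ha haK => notMem_of_mem_complComp hd ha haK)
    have hnear : ∀ s ∈ S, ¬ G.IsNear L K d s := by
      rintro s hs ⟨Q, hQ, hQs⟩
      obtain ⟨e, heP, heQ⟩ := hint P Q hP hQ
      rcases hQs e heQ with h | h
      · exact hdis e h (hPC e heP)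
      · exact notMem_of_mem_complComp hcS (hPC e heP) (h ▸ hs)
    rcases hdcap with ⟨Q, hQ, hQd⟩ | ⟨-, s, hs, t, ht, hst, h1, h2⟩
    · obtain ⟨e, heP, heQ⟩ := hint P Q hP hQ
      exact hdis e (hQd e heQ) (hPC e heP)
    · rcases Finset.mem_insert.1 hs with rfl | hs
      · rcases Finset.mem_insert.1 ht with rfl | ht
        · exact hst rfl
        · exact hnear t ht h2
      · exact hnear s hs h1
  have hK4 : K.card = 4 := by rw [hKdef, Finset.card_insert_of_notMem hvS]; omega
  have hvK : v ∈ K := Finset.mem_insert_self _ _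
  have hSK : S ⊆ K := Finset.subset_insert _ _
  have hcapr : ∀ r ∈ K, ∃ d, d ∉ K.erase r ∧ G.Captures L (K.erase r) d ∧
      r ∈ G.complComp (K.erase r : Finset V) d := by
    intro r hr
    by_cases hrv : r = v
    · subst hrv
      have : K.erase r = S := by rw [hKdef, Finset.erase_insert hvS]
      rw [this]
      exact ⟨c, hcS, hcap, hvC⟩
    have hTc : (K.erase r).card = 3 := by rw [Finset.card_erase_of_mem hr]; omega
    obtain ⟨d, hd, hdcap⟩ := exists_captures hL hL2 hav
      (hK.subset (Finset.coe_subset.2 (Finset.erase_subset r K))) hTc.le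
    have hd' : d ∉ ((K.erase r : Finset V) : Set V) := hd
    refine ⟨d, hd, hdcap, ?_⟩
    by_contra hrd
    have hdK : ∀ a ∈ G.complComp (K.erase r : Finset V) d, a ∉ K := by
      intro a ha haK
      by_cases har : a = r
      · exact hrd (har ▸ ha)
      · exact notMem_of_mem_complComp hd' ha
          (Finset.mem_coe.2 (Finset.mem_erase.2 ⟨har, haK⟩))
    have hdis := hsub _ d (Finset.erase_subset r K) hTc.le hd hdcap hdK
    have hvd : ¬ G.Touches (K.erase r : Finset V) d v := by
      rintro ⟨u, hu, hvu⟩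
      exact hdis u hu (mem_complComp_of_adj hcS hvC hvu fun h => hdK u hu (hSK h))
    -- no longest path is near `d` and another one near `c` at different vertices
    have hnn : ∀ s ∈ S, ∀ t ∈ K, s ≠ t → G.IsNear L S c s →
        G.IsNear L (K.erase r : Finset V) d t → False := by
      rintro s hs t ht hst ⟨P, hP, hPs⟩ hn'
      have hex : ∃ Q, G.IsPathOfCard L Q ∧
          ∀ a ∈ Q, a ∈ G.complComp (K.erase r : Finset V) d ∨ a = t ∧ t ≠ v := by
        by_cases htv : t = v
        · obtain ⟨Q, hQ, hQd⟩ := hn'.exists_of_not_touches hL2 (htv ▸ hvd)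
          exact ⟨Q, hQ, fun a ha => Or.inl (hQd a ha)⟩
        · obtain ⟨Q, hQ, hQd⟩ := hn'
          exact ⟨Q, hQ, fun a ha => (hQd a ha).imp_right fun h => ⟨h, htv⟩⟩
      obtain ⟨Q, hQ, hQd⟩ := hex
      obtain ⟨e, heP, heQ⟩ := hint P Q hP hQ
      rcases hQd e heQ with h | ⟨rfl, htv⟩ <;> rcases hPs e heP with h' | h'
      · exact hdis e h h'
      · exact hdK e h (hSK (h' ▸ hs))
      · exact notMem_of_mem_complComp hcS h' (Finset.mem_of_mem_insert_of_ne ht htv)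
      · exact hst h'.symm
    have hnc : ∃ s ∈ S, ∃ t ∈ S, s ≠ t ∧ G.IsNear L S c s ∧ G.IsNear L S c t := by
      rcases hcap with ⟨P, hP, hPC⟩ | ⟨-, h⟩
      · obtain ⟨s, hs, t, ht, hst⟩ := Finset.one_lt_card.1 (show 1 < S.card by omega)
        exact ⟨s, hs, t, ht, hst, ⟨P, hP, fun a ha => Or.inl (hPC a ha)⟩,
          ⟨P, hP, fun a ha => Or.inl (hPC a ha)⟩⟩
      · exact h
    obtain ⟨s, hs, t, ht, hst, h1, h2⟩ := hnc
    have hnd : ∃ u ∈ K, G.IsNear L (K.erase r : Finset V) d u := by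
      rcases hdcap with ⟨Q, hQ, hQd⟩ | ⟨-, u, hu, -, -, -, h, -⟩
      · exact ⟨v, hvK, Q, hQ, fun a ha => Or.inl (hQd a ha)⟩
      · exact ⟨u, Finset.mem_of_mem_erase hu, h⟩
    obtain ⟨u, hu, hnu⟩ := hnd
    -- Two choices of the extra vertex on the side of `c` allow one different from `u`; the two
    -- longest paths are then disjoint.
    by_cases hsu : s = u
    · exact hnn t ht u hu (fun h => hst (hsu.trans h.symm)) h2 hnu
    · exact hnn s hs u hu hsu h1 hnu
  obtain ⟨d, hdK, hd⟩ := exists_forall_touches_of_hasArrow hL hint hK hK4 (by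
    intro r hr
    obtain ⟨d, hd, hdcap, hrd⟩ := hcapr r hr
    have hd' : d ∉ ((K.erase r : Finset V) : Set V) := hd
    have harrow : ∀ x ∈ K.erase r, G.IsNear L (K.erase r : Finset V) d x →
        G.HasArrow L K x r := by
      rintro x hx ⟨P, hP, hPx⟩
      refine ⟨P, hP, ?_, ?_⟩
      · intro a ha haK
        rcases hPx a ha with h | h
        · right
          by_contra har
          exact notMem_of_mem_complComp hd' h (Finset.mem_coe.2 (Finset.mem_erase.2 ⟨har, haK⟩))
        · exact Or.inl h
      · intro a ha haK
        rcases hPx a ha with h | h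
        · rw [← complComp_eq_of_mem hrd] at h
          have := touches_insert_of_mem_complComp h (fun h => haK (h ▸ hr))
          rwa [← Finset.coe_insert, Finset.insert_erase hr] at this
        · exact absurd (Finset.mem_coe.2 (Finset.mem_of_mem_erase hx)) (h ▸ haK)
    have h2 : ∃ x ∈ K.erase r, ∃ y ∈ K.erase r, x ≠ y ∧
        G.IsNear L (K.erase r : Finset V) d x ∧ G.IsNear L (K.erase r : Finset V) d y := by
      rcases hdcap with ⟨Q, hQ, hQd⟩ | ⟨-, h⟩
      · obtain ⟨s, hs, t, ht, hst⟩ := Finset.one_lt_card.1 (show 1 < (K.erase r).card by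
          rw [Finset.card_erase_of_mem hr]; omega)
        exact ⟨s, hs, t, ht, hst, ⟨Q, hQ, fun a ha => Or.inl (hQd a ha)⟩,
          ⟨Q, hQ, fun a ha => Or.inl (hQd a ha)⟩⟩
      · exact h
    obtain ⟨x, hx, y, hy, hxy, h1, h2⟩ := h2
    exact ⟨x, Finset.mem_of_mem_erase hx, y, Finset.mem_of_mem_erase hy, hxy,
      Finset.ne_of_mem_erase hx, Finset.ne_of_mem_erase hy, harrow x hx h1, harrow y hy h2⟩)
  -- The component of `d` is touched by all of `K`, so its cone together with `K` is a 5-clique.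
  obtain ⟨w, hw, hwK⟩ := hcone K hK d hdK
  have hwK' : w ∉ K := notMem_of_mem_complComp (S := (K : Set V)) hdK hw
  refine h5 (insert w K) ⟨?_, by rw [Finset.card_insert_of_notMem hwK', hK4]⟩
  rw [Finset.coe_insert]
  exact hK.insert fun s hs _ => (hwK s hs (hd s hs)).symm

/-! ### Intersecting longest paths, and the bound from cones -/

/-- Two paths with a common first vertex and no other common vertex can be joined. -/
theorem IsPathList.glue {u : V} {A T : List V} (hA : G.IsPathList (u :: A))
    (hT : G.IsPathList (u :: T)) (hd : ∀ a ∈ A, a ∉ T) : G.IsPathList (A.reverse ++ u :: T) := by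
  cases A with
  | nil => simpa using hT
  | cons a A =>
    have hua : G.Adj u a := by
      have := hA.2; rw [List.isChain_cons_cons] at this; exact this.1
    have := hA.tail.join hT hua.symm (fun b hb hb' => by
      rcases List.mem_cons.1 hb' with h | h
      · exact hA.notMem_of_cons (h ▸ hb)
      · exact hd b hb h)
    simpa using this

theorem Walk.IsPath.isPathList_support {u v : V} {p : G.Walk u v} (hp : p.IsPath) :
    G.IsPathList p.support := ⟨hp.support_nodup, p.isChain_adj_support⟩

/-- Any two longest paths of a connected graph have a common vertex. -/
theorem Connected.exists_mem_of_isPathOfCard (hG : G.Connected)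
    (hL : ∀ l, G.IsPathList l → l.length ≤ L) (hL1 : 1 ≤ L) {P Q : List V}
    (hP : G.IsPathOfCard L P) (hQ : G.IsPathOfCard L Q) : ∃ c ∈ P, c ∈ Q := by
  classical
  by_contra! hcon
  obtain ⟨a, ha⟩ : ∃ a, a ∈ P := List.exists_mem_of_length_pos (by have := hP.2; omega)
  obtain ⟨b, hb⟩ : ∃ b, b ∈ Q := List.exists_mem_of_length_pos (by have := hQ.2; omega)
  have hex : ∃ n, ∃ u v, ∃ p : G.Walk u v, u ∈ P ∧ v ∈ Q ∧ p.length = n := by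
    obtain ⟨p⟩ := hG.preconnected a b
    exact ⟨_, a, b, p, ha, hb, rfl⟩
  obtain ⟨u, v, p, hu, hv, hpn⟩ := Nat.find_spec hex
  have hmin : ∀ {x y : V} (q : G.Walk x y), x ∈ P → y ∈ Q → Nat.find hex ≤ q.length :=
    fun q hx hy => Nat.find_min' hex ⟨_, _, q, hx, hy, rfl⟩
  obtain ⟨q, hq, hqn⟩ : ∃ q : G.Walk u v, q.IsPath ∧ q.length = Nat.find hex :=
    ⟨p.bypass, p.bypass_isPath, le_antisymm (hpn ▸ p.length_bypass_le_length) (hmin _ hu hv)⟩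
  have hqP : ∀ x ∈ q.support, x ∈ P → x = u := by
    intro x hx hxP
    have h1 := hmin (q.dropUntil x hx) hxP hv
    have h2 := congrArg Walk.length (q.take_spec hx)
    rw [Walk.length_append] at h2
    exact (Walk.eq_of_length_eq_zero (p := q.takeUntil x hx) (by omega)).symm
  have hqQ : ∀ x ∈ q.support, x ∈ Q → x = v := by
    intro x hx hxP
    have h1 := hmin (q.takeUntil x hx) hu hxP
    have h2 := congrArg Walk.length (q.take_spec hx)
    rw [Walk.length_append] at h2
    exact Walk.eq_of_length_eq_zero (p := q.dropUntil x hx) (by omega)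
  obtain ⟨A', A, -, hA, -, hlA, hleA, hmA⟩ := hP.1.exists_split hu
  obtain ⟨B', B, -, hB, -, hlB, hleB, hmB⟩ := hQ.1.exists_split hv
  have huv : u ≠ v := fun h => hcon u hu (h ▸ hv)
  have hsup := hq.isPathList_support
  rw [← Walk.cons_tail_support] at hsup
  have hg1 := hA.glue hsup (fun x hx hx' => by
    have hxq : x ∈ q.support := List.mem_of_mem_tail hx'
    have := hqP x hxq ((hmA x).2 (by tauto))
    exact hA.notMem_of_cons (this ▸ hx))
  rw [Walk.cons_tail_support] at hg1
  have hrev := hg1.reverse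
  have hsr : q.support.reverse = v :: q.reverse.support.tail := by
    rw [← Walk.support_reverse, Walk.cons_tail_support]
  rw [List.reverse_append, hsr, List.cons_append] at hrev
  have hg2 := hB.glue hrev (fun x hx hx' => by
    have hxQ : x ∈ Q := (hmB x).2 (by tauto)
    rcases List.mem_append.1 hx' with h | h
    · have hxq : x ∈ q.support := by
        have := List.mem_of_mem_tail h
        rwa [Walk.support_reverse, List.mem_reverse] at this
      have := hqQ x hxq hxQ
      exact hB.notMem_of_cons (this ▸ hx)
    · exact hcon x ((hmA x).2 (by simp at h; tauto)) hxQ)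
  -- The longer halves contribute at least `L - 1` vertices besides `u` and `v`, and the connecting
  -- path at least two more.
  have h := hL _ hg2
  have hql : 0 < q.length := by
    rw [Nat.pos_iff_ne_zero]
    exact fun h => huv (Walk.eq_of_length_eq_zero h)
  have hPl := hP.2
  have hQl := hQ.2
  simp at h
  omega

/-- A connected graph without 5-cliques in which clique separators have cones has a longest path
transversal with at most two vertices. -/
theorem lpt_le_two_of_hasCones [Fintype V] (hG : G.Connected) (hcone : G.HasCones)
    (h5 : G.CliqueFree 5) : G.lpt ≤ 2 := by
  classical
  by_contra hlpt
  have hnt : ∀ S : Finset V, S.card ≤ 2 → ∃ (u v : V) (p : G.Walk u v), G.IsLongestPath p ∧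
      ∀ w ∈ S, w ∉ p.support := by
    intro S hS
    by_contra! hcon
    refine hlpt (le_trans (Nat.sInf_le ⟨S, ?_, rfl⟩) hS)
    intro u v p hp
    exact hcon u v p hp
  obtain ⟨u, v, p, hp, -⟩ := hnt ∅ (by simp)
  -- Walk lengths count edges and `L` counts vertices, hence the shift by one.
  have hL : ∀ l, G.IsPathList l → l.length ≤ p.length + 1 := by
    intro l hl
    by_cases hne : l = []
    · simp [hne]
    · have h1 := hp.2 _ _ (Walk.ofSupport l hne hl.2) (by
        rw [Walk.isPath_def, Walk.support_ofSupport]; exact hl.1)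
      rw [Walk.length_ofSupport] at h1
      omega
  have hav : ∀ a b, ∃ P, G.IsPathOfCard (p.length + 1) P ∧ a ∉ P ∧ b ∉ P := by
    intro a b
    obtain ⟨x, y, q, hq, hqS⟩ := hnt {a, b} Finset.card_le_two
    refine ⟨q.support, ⟨hq.1.isPathList_support, ?_⟩, hqS a (by simp), hqS b (by simp)⟩
    rw [Walk.length_support]
    have h1 := hp.2 _ _ q hq.1
    have h2 := hq.2 _ _ p hp.1
    omega
  have hint := fun P Q (hP : G.IsPathOfCard (p.length + 1) P) hQ =>
    hG.exists_mem_of_isPathOfCard hL (by omega) hP (Q := Q) hQ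
  have hL2 : 2 ≤ p.length + 1 := by
    by_contra hlt
    obtain ⟨Q, hQ, huQ, -⟩ := hav u u
    obtain ⟨c, hc, hcQ⟩ := hint [u] Q ⟨IsPathList.singleton u, by rw [List.length_singleton]; omega⟩ hQ
    simp at hc
    exact huQ (hc ▸ hcQ)
  have : Nonempty V := ⟨u⟩
  obtain ⟨c, hc, hcap⟩ := exists_captures (S := ∅) hL hL2 hav (by simp) (by simp)
  exact false_of_captures hL hL2 hint hav hcone h5 _ ∅ c (by simp) (by simp) hc hcap rfl

end SimpleGraph

/-! ### k-trees: cones, connectedness, clique number -/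

namespace SimpleGraph

variable {V : Type*} {G : SimpleGraph V} {k : ℕ}

/-- A vertex set that cannot be split into two nonempty parts without an edge between them. -/
def IsCutConnected (G : SimpleGraph V) (C : Set V) : Prop :=
  ∀ D ⊆ C, D.Nonempty → D ≠ C → ∃ a ∈ D, ∃ b ∈ C, b ∉ D ∧ G.Adj a b

theorem isCutConnected_complComp {S : Set V} {c : V} (hc : c ∉ S) :
    G.IsCutConnected (G.complComp S c) := by
  have key : ∀ D ⊆ G.complComp S c, c ∈ D → D ≠ G.complComp S c →
      ∃ a ∈ D, ∃ b ∈ G.complComp S c, b ∉ D ∧ G.Adj a b := by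
    intro D hD hcD hne
    by_contra! hcon
    refine hne (Set.Subset.antisymm hD fun u hu => ?_)
    induction hu with
    | refl => exact hcD
    | @tail a b _ hab ih =>
      by_contra hb
      exact hcon a ih b (mem_complComp_of_adj hc (hD ih) hab.1 hab.2.2) hb hab.1
  intro D hD hDn hne
  by_cases hcD : c ∈ D
  · exact key D hD hcD hne
  · obtain ⟨a, ha, b, hb, hbD, hab⟩ := key (G.complComp S c \ D) Set.sdiff_subset
      ⟨self_mem_complComp _ _, hcD⟩ (fun h => by
        obtain ⟨d, hd⟩ := hDn
        exact (h.ge (hD hd)).2 hd)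
    have hbD' : b ∈ D := by
      by_contra h
      exact hbD ⟨hb, h⟩
    exact ⟨b, hbD', a, ha.1, ha.2, hab.symm⟩

/-- The separator is replaced by the condition that outside neighbours of `C` are pairwise adjacent,
which survives removal of the last vertex `v`. If `v` lies in `C`, its neighbours in `C` belong to
the clique `K`, so `C \ {v}` is still connected and keeps all outside neighbours. If `v` lies
outside and sees some `u` in `C`, the other outside neighbours are adjacent to `v`, so they lie in
`K` with `u`, and `u` is a cone. -/
theorem IsKTreeOn.exists_cone {W : Set V} (hW : G.IsKTreeOn k W) :
    ∀ C ⊆ W, C.Nonempty → G.IsCutConnected C →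
      (∀ x ∈ W, ∀ y ∈ W, x ∉ C → y ∉ C → x ≠ y → (∃ u ∈ C, G.Adj x u) → (∃ u ∈ C, G.Adj y u) →
        G.Adj x y) →
      ∃ v ∈ C, ∀ x ∈ W, x ∉ C → (∃ u ∈ C, G.Adj x u) → G.Adj x v := by
  induction hW with
  | base K hK =>
    rintro C hC ⟨v, hv⟩ - -
    exact ⟨v, hv, fun x hx hxC _ => hK.1 hx (hC hv) (fun h => hxC (h ▸ hv))⟩
  | step W v K _ hv hKW hK hadj ih =>
    intro C hC hCn hcut hcl
    have hvK : ∀ u ∈ C, G.Adj v u → u ∈ K := by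
      intro u hu hvu
      rcases hC hu with rfl | h
      · exact absurd hvu (G.loopless.irrefl _)
      · exact (hadj u h).1 hvu
    by_cases hvC : v ∈ C
    · by_cases hCe : C = {v}
      · refine ⟨v, hvC, ?_⟩
        rintro x - - ⟨u, hu, hxu⟩
        rw [hCe] at hu
        obtain rfl : u = v := hu
        exact hxu
      obtain ⟨v', hv', b, hb, hbv, hvb⟩ := hcut {v} (by simpa using hvC) (by simp) (Ne.symm hCe)
      rw [Set.mem_singleton_iff.1 hv'] at hvb
      have hbK := hvK b hb hvb
      have hsub : C \ {v} ⊆ W := by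
        rintro x ⟨hx, hxv⟩
        exact (hC hx).resolve_left hxv
      -- neighbours of `C` are neighbours of `C \ {v}`
      have hnb : ∀ x ∈ W, x ∉ C → (∃ u ∈ C, G.Adj x u) → ∃ u ∈ C \ {v}, G.Adj x u := by
        rintro x hx hxC ⟨u, hu, hxu⟩
        by_cases huv : u = v
        · subst huv
          have hxK := (hadj x hx).1 hxu.symm
          exact ⟨b, ⟨hb, hbv⟩, hK.1 hxK hbK (fun h => hxC (h ▸ hb))⟩
        · exact ⟨u, ⟨hu, huv⟩, hxu⟩
      have hout : ∀ x ∈ W, x ∉ C \ {v} → x ∉ C := fun x hx hxC h =>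
        hxC ⟨h, fun h' => hv (h' ▸ hx)⟩
      obtain ⟨w, hw, hw'⟩ := ih (C \ {v}) hsub ⟨b, hb, hbv⟩ (by
        -- For a side of the cut without neighbours of `v`, the edge leaving it inside `C` cannot
        -- end in `v`.
        have key : ∀ D ⊆ C \ {v}, D ≠ C \ {v} → D.Nonempty →
            (∀ a ∈ K, a ∈ C → a ∉ D) →
            ∃ a ∈ D, ∃ b ∈ C \ {v}, b ∉ D ∧ G.Adj a b := by
          intro D hD hne hDn hKD
          obtain ⟨a, ha, e, he, heD, hae⟩ := hcut D (hD.trans Set.sdiff_subset) hDn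
            (fun h => (hD (h ▸ hvC)).2 rfl)
          refine ⟨a, ha, e, ⟨he, ?_⟩, heD, hae⟩
          rintro rfl
          exact hKD a (hvK a (hD ha).1 hae.symm) (hD ha).1 ha
        intro D hD hDn hne
        by_contra! hcon
        have hD' : ∀ a ∈ K, a ∈ C → a ∈ D → ∀ e ∈ K, e ∈ C → e ∈ D := by
          intro a haK haC haD e heK heC
          by_contra heD
          exact hcon a haD e ⟨heC, fun h => hv (hKW (h ▸ heK))⟩ heD
            (hK.1 haK heK (fun h => heD (h ▸ haD)))
        -- If no edge crosses the cut, the clique `K ∩ C` lies on one side, so `key` applies to the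
        -- other.
        by_cases hKD : ∀ a ∈ K, a ∈ C → a ∉ D
        · obtain ⟨a, ha, e, he, heD, hae⟩ := key D hD hne hDn hKD
          exact hcon a ha e he heD hae
        · push Not at hKD
          obtain ⟨a, haK, haC, haD⟩ := hKD
          obtain ⟨e, he, f, hf, hfD, hef⟩ := key ((C \ {v}) \ D) Set.sdiff_subset
            (fun h => (h.ge (hD haD)).2 haD)
            (by
              by_contra hemp
              rw [Set.not_nonempty_iff_eq_empty, Set.sdiff_eq_empty] at hemp
              exact hne (Set.Subset.antisymm hD hemp))
            (fun e heK heC he => he.2 (hD' a haK haC haD e heK heC))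
          have hfD' : f ∈ D := by
            by_contra h
            exact hfD ⟨hf, h⟩
          exact hcon f hfD' e he.1 he.2 hef.symm) (by
        rintro x hx y hy hxC hyC hxy ⟨u, hu, hxu⟩ ⟨w, hw, hyw⟩
        exact hcl x (Or.inr hx) y (Or.inr hy) (hout x hx hxC) (hout y hy hyC) hxy
          ⟨u, hu.1, hxu⟩ ⟨w, hw.1, hyw⟩)
      refine ⟨w, hw.1, ?_⟩
      rintro x hx hxC hxu
      have hxW : x ∈ W := hx.resolve_left (fun h => hxC (h ▸ hvC))
      exact hw' x hxW (fun h => hxC h.1) (hnb x hxW hxC hxu)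
    · have hCW : C ⊆ W := fun x hx => (hC hx).resolve_left (fun h => hvC (h ▸ hx))
      by_cases hvu : ∃ u ∈ C, G.Adj v u
      · obtain ⟨u, hu, hvu⟩ := hvu
        have huK := hvK u hu hvu
        refine ⟨u, hu, fun x hx hxC hxn => ?_⟩
        rcases hx with rfl | hx
        · exact hvu
        · have hxv : G.Adj v x := hcl v (Or.inl rfl) x (Or.inr hx) hvC hxC
            (fun h => hv (h ▸ hx)) ⟨u, hu, hvu⟩ hxn
          exact hK.1 ((hadj x hx).1 hxv) huK (fun h => hxC (h ▸ hu))
      · obtain ⟨w, hw, hw'⟩ := ih C hCW hCn hcut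
          (fun x hx y hy => hcl x (Or.inr hx) y (Or.inr hy))
        refine ⟨w, hw, fun x hx hxC hxn => ?_⟩
        rcases hx with rfl | hx
        · exact absurd hxn hvu
        · exact hw' x hx hxC hxn

theorem IsKTree.hasCones (hG : G.IsKTree k) : G.HasCones := by
  intro S hS c hc
  have hout : ∀ x, x ∉ G.complComp S c → (∃ u ∈ G.complComp S c, G.Adj x u) → x ∈ S := by
    rintro x hx ⟨u, hu, hxu⟩
    by_contra hxS
    exact hx (mem_complComp_of_adj hc hu hxu.symm hxS)
  obtain ⟨v, hv, hv'⟩ := IsKTreeOn.exists_cone hG (G.complComp S c) (Set.subset_univ _)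
    ⟨c, self_mem_complComp _ _⟩ (isCutConnected_complComp hc)
    (fun x _ y _ hx hy hxy hxu hyu => hS (hout x hx hxu) (hout y hy hyu) hxy)
  exact ⟨v, hv, fun s hs hsC => hv' s trivial
    (fun h => notMem_of_mem_complComp (S := (S : Set V)) hc h hs) hsC⟩

theorem IsKTreeOn.reachable {W : Set V} (hk : 0 < k) (hW : G.IsKTreeOn k W) :
    W.Nonempty ∧ ∀ a ∈ W, ∀ b ∈ W, G.Reachable a b := by
  induction hW with
  | base K hK =>
    refine ⟨Finset.card_pos.1 (by rw [hK.2]; exact hk), fun a ha b hb => ?_⟩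
    by_cases hab : a = b
    · rw [hab]
    · exact (hK.1 ha hb hab).reachable
  | step W v K _ hv hKW hK hadj ih =>
    obtain ⟨u, hu⟩ : K.Nonempty := Finset.card_pos.1 (by rw [hK.2]; exact hk)
    have huW := hKW hu
    have hvu : G.Adj v u := (hadj u huW).2 hu
    have key : ∀ a ∈ insert v W, G.Reachable a u := by
      rintro a (rfl | ha)
      · exact hvu.reachable
      · exact ih.2 a ha u huW
    exact ⟨⟨v, Or.inl rfl⟩, fun a ha b hb => (key a ha).trans (key b hb).symm⟩

theorem IsKTree.connected (hk : 0 < k) (hG : G.IsKTree k) : G.Connected := by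
  obtain ⟨⟨v, -⟩, h⟩ := IsKTreeOn.reachable hk hG
  have : Nonempty V := ⟨v⟩
  exact ⟨fun a b => h a trivial b trivial⟩

theorem IsKTreeOn.card_le {W : Set V} (hW : G.IsKTreeOn k W) :
    ∀ Q : Finset V, (Q : Set V) ⊆ W → G.IsClique (Q : Set V) → Q.card ≤ k + 1 := by
  classical
  induction hW with
  | base K hK =>
    intro Q hQ _
    have := Finset.card_le_card (Finset.coe_subset.1 hQ)
    have := hK.2
    omega
  | step W v K _ hv hKW hK hadj ih =>
    intro Q hQ hQc
    by_cases hvQ : v ∈ Q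
    · have hsub : Q.erase v ⊆ K := by
        intro u hu
        have huv := Finset.ne_of_mem_erase hu
        have huQ := Finset.mem_of_mem_erase hu
        exact (hadj u ((hQ huQ).resolve_left huv)).1 (hQc hvQ huQ huv.symm)
      have h1 := Finset.card_le_card hsub
      have h2 := hK.2
      have h3 := Finset.card_erase_add_one hvQ
      omega
    · exact ih Q (fun x hx => (hQ hx).resolve_left (fun h => hvQ (h ▸ hx))) hQc

theorem IsKTree.cliqueFree (hG : G.IsKTree k) : G.CliqueFree (k + 2) := by
  intro Q hQ
  have := IsKTreeOn.card_le hG Q (Set.subset_univ _) hQ.1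
  have := hQ.2
  omega

end SimpleGraph

/-! ### Chordal graphs: cones -/

namespace SimpleGraph

variable {V : Type*} {G : SimpleGraph V}

theorem Walk.mk_mem_edges_of_length_le_one {a b : V} (p : G.Walk a b) (hab : a ≠ b)
    (hp : p.length ≤ 1) : s(a, b) ∈ p.edges := by
  cases p with
  | nil => exact absurd rfl hab
  | cons h q =>
    cases q with
    | nil => simp
    | cons h' q => simp at hp

/-- In a chordal graph, let `s` be a vertex that touches the vertex set `C`, and `v` a vertex
connected within `C` to a neighbour of `s`. Then `s` has a neighbour in `C` whose neighbourhood
contains all neighbours of `v` among the neighbours of `s` outside `C`. -/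
theorem IsChordal.exists_adj_of_walk (hG : G.IsChordal) {C : Set V} {s v w₀ : V} (hsC : s ∉ C)
    (p₀ : G.Walk v w₀) (hp₀ : ∀ x ∈ p₀.support, x ∈ C) (hsw₀ : G.Adj s w₀) :
    ∃ w ∈ C, G.Adj s w ∧ ∀ t ∉ C, G.Adj t s → G.Adj t v → G.Adj t w := by
  classical
  -- The end `w` of a shortest walk within `C` from `v` to a neighbour of `s` is fixed before `t`,
  -- so that it serves all `t` at once.
  have hex : ∃ n, ∃ w, ∃ p : G.Walk v w, (∀ x ∈ p.support, x ∈ C) ∧ G.Adj s w ∧ p.length = n :=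
    ⟨_, w₀, p₀, hp₀, hsw₀, rfl⟩
  obtain ⟨w, p, hpC, hsw, hpn⟩ := Nat.find_spec hex
  have hmin : ∀ {y : V} (q : G.Walk v y), (∀ x ∈ q.support, x ∈ C) → G.Adj s y →
      p.length ≤ q.length := fun q hq hy => by
    rw [hpn]; exact Nat.find_min' hex ⟨_, q, hq, hy, rfl⟩
  refine ⟨w, hpC w p.end_mem_support, hsw, fun t htC hts htv => ?_⟩
  -- a shortest walk from a neighbour of `t` to `w` among those that are geodesic towards `s`
  have hex2 : ∃ n, ∃ x, ∃ D : G.Walk x w, (∀ y ∈ D.support, y ∈ C) ∧ G.Adj t x ∧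
      (∀ (y : V) (q : G.Walk x y), (∀ z ∈ q.support, z ∈ C) → G.Adj s y → D.length ≤ q.length) ∧
      D.length = n := ⟨_, v, p, hpC, htv, fun _ q => hmin q, rfl⟩
  obtain ⟨x, D, hDC, htx, hDg, hDn⟩ := Nat.find_spec hex2
  have hDmin : ∀ y ∈ D.support, G.Adj t y → y = x := by
    intro y hy hty
    have hl := congrArg Walk.length (D.take_spec hy)
    rw [Walk.length_append] at hl
    have := Nat.find_min' hex2 ⟨y, D.dropUntil y hy,
      fun z hz => hDC z (D.support_dropUntil_subset_support hy hz), hty, fun y' q hq hsy' => by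
        have := hDg y' ((D.takeUntil y hy).append q) (fun z hz => by
          rcases Walk.mem_support_append_iff _ _ |>.1 hz with h | h
          · exact hDC z (D.support_takeUntil_subset_support hy h)
          · exact hq z h) hsy'
        rw [Walk.length_append] at this
        omega, rfl⟩
    exact (Walk.eq_of_length_eq_zero (p := D.takeUntil y hy) (by omega)).symm
  have hDs : ∀ y ∈ D.support, G.Adj s y → y = w := by
    intro y hy hsy
    have hl := congrArg Walk.length (D.take_spec hy)
    rw [Walk.length_append] at hl
    have := hDg y (D.takeUntil y hy)
      (fun z hz => hDC z (D.support_takeUntil_subset_support hy hz)) hsy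
    exact Walk.eq_of_length_eq_zero (p := D.dropUntil y hy) (by omega)
  have hDpath : D.IsPath := by
    have h1 := hDg w D.bypass (fun z hz => hDC z (D.support_bypass_subset_support hz)) hsw
    have h2 := D.length_bypass_le_length
    rw [← Walk.bypass_eq_self_of_length_le_length_bypass D h1]
    exact D.bypass_isPath
  have hDind : ∀ a ∈ D.support, ∀ b ∈ D.support, G.Adj a b → s(a, b) ∈ D.edges := by
    intro a ha b hb hab
    have hspec := D.take_spec ha
    have hl := congrArg Walk.length hspec
    rw [Walk.length_append] at hl
    have hb' := hb
    rw [← hspec, Walk.mem_support_append_iff] at hb'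
    rcases hb' with hb' | hb'
    · have hl2 := congrArg Walk.length ((D.takeUntil a ha).take_spec hb')
      rw [Walk.length_append] at hl2
      have := hDg w (((D.takeUntil a ha).takeUntil b hb').append
          (Walk.cons hab.symm (D.dropUntil a ha))) (fun z hz => by
        rw [Walk.mem_support_append_iff, Walk.support_cons, List.mem_cons] at hz
        rcases hz with h | h | h
        · exact hDC z (D.support_takeUntil_subset_support ha
            (Walk.support_takeUntil_subset_support _ hb' h))
        · exact h ▸ hDC b hb
        · exact hDC z (D.support_dropUntil_subset_support ha h)) hsw
      rw [Walk.length_append, Walk.length_cons] at this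
      have h3 := Walk.mk_mem_edges_of_length_le_one ((D.takeUntil a ha).dropUntil b hb')
        hab.ne.symm (by omega)
      rw [Sym2.eq_swap]
      exact D.edges_takeUntil_subset_edges ha (Walk.edges_dropUntil_subset_edges _ hb' h3)
    · have hl2 := congrArg Walk.length ((D.dropUntil a ha).take_spec hb')
      rw [Walk.length_append] at hl2
      have := hDg w ((D.takeUntil a ha).append
          (Walk.cons hab ((D.dropUntil a ha).dropUntil b hb'))) (fun z hz => by
        rw [Walk.mem_support_append_iff, Walk.support_cons, List.mem_cons] at hz
        rcases hz with h | h | h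
        · exact hDC z (D.support_takeUntil_subset_support ha h)
        · exact h ▸ hDC a ha
        · exact hDC z (D.support_dropUntil_subset_support ha
            (Walk.support_dropUntil_subset_support _ hb' h))) hsw
      rw [Walk.length_append, Walk.length_cons] at this
      have h3 := Walk.mk_mem_edges_of_length_le_one ((D.dropUntil a ha).takeUntil b hb')
        hab.ne (by omega)
      exact D.edges_dropUntil_subset_edges ha (Walk.edges_takeUntil_subset_edges _ hb' h3)
  have hsD : s ∉ D.support := fun h => hsC (hDC s h)
  have htD : t ∉ D.support := fun h => htC (hDC t h)
  have hxs : x ≠ s := fun h => hsC (h ▸ hDC x D.start_mem_support)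
  have hwt : w ≠ t := fun h => htC (h ▸ hDC w D.end_mem_support)
  have hcyc : (Walk.cons htx ((D.concat hsw.symm).concat hts.symm)).IsCycle := by
    rw [Walk.cons_isCycle_iff]
    refine ⟨(hDpath.concat hsD hsw.symm).concat ?_ hts.symm, ?_⟩
    · rw [Walk.support_concat]
      simp [htD, hts.ne]
    · rw [Walk.edges_concat, Walk.edges_concat]
      simp only [List.concat_eq_append, List.append_assoc, List.mem_append, List.mem_singleton]
      rintro (h | h | h)
      · exact htD (D.fst_mem_support_of_mem_edges h)
      · have := hts.ne
        simp only [Sym2.eq_iff] at h; tauto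
      · have := hts.ne
        simp only [Sym2.eq_iff] at h; tauto
  have hlen := hG t _ hcyc (by
    rw [Walk.isChordless_iff_forall_mem_edges]
    have key : ∀ a b, G.Adj a b → (a = t ∨ a ∈ D.support ∨ a = s) →
        (b = t ∨ b ∈ D.support ∨ b = s) →
        s(a, b) ∈ s(t, x) :: D.edges ++ [s(w, s), s(s, t)] := by
      intro a b hab ha hb
      simp only [List.cons_append, List.mem_cons, List.mem_append, List.not_mem_nil, or_false]
      rcases ha with rfl | ha | rfl <;> rcases hb with rfl | hb | rfl
      · exact absurd hab (G.loopless.irrefl _)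
      · rw [hDmin b hb hab]; simp
      · right; right; right; exact Sym2.eq_swap
      · rw [hDmin a ha hab.symm]; left; exact Sym2.eq_swap
      · right; left; exact hDind a ha b hb hab
      · rw [hDs a ha hab.symm]; simp
      · simp
      · rw [hDs b hb hab]; right; right; left; exact Sym2.eq_swap
      · exact absurd hab (G.loopless.irrefl _)
    intro a b ha hb hab
    simp only [Walk.support_cons, Walk.support_concat, List.mem_cons,
      List.mem_append, List.not_mem_nil, or_false] at ha hb
    have := key a b hab (by tauto) (by tauto)
    simpa [Walk.edges_cons, Walk.edges_concat] using this)
  rw [Walk.length_cons, Walk.length_concat, Walk.length_concat] at hlen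
  -- The chordless cycle through `t`, `D` and `s` has three edges besides those of `D`, so `D` is
  -- trivial and the neighbour `x` of `t` is `w`.
  have := Walk.eq_of_length_eq_zero (p := D) (by omega)
  exact this ▸ htx

theorem exists_walk_of_mem_complComp {S : Set V} {c u : V} (hc : c ∉ S)
    (hu : u ∈ G.complComp S c) : ∃ p : G.Walk c u, ∀ x ∈ p.support, x ∈ G.complComp S c := by
  induction hu with
  | refl => exact ⟨Walk.nil, by simp [self_mem_complComp]⟩
  | @tail a b h hab ih =>
    obtain ⟨p, hp⟩ := ih
    refine ⟨p.concat hab.1, fun x hx => ?_⟩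
    rw [Walk.support_concat, List.mem_append, List.mem_singleton] at hx
    rcases hx with hx | rfl
    · exact hp x hx
    · exact mem_complComp_of_adj hc h hab.1 hab.2.2

/-- A vertex `v` of the component with the most neighbours in `S` is a cone: if it missed a touching
`s`, `exists_adj_of_walk` would give a vertex of the component that keeps all neighbours of `v` in
`S` and gains `s`. -/
theorem IsChordal.hasCones [Finite V] (hG : G.IsChordal) : G.HasCones := by
  classical
  intro S hS c hc
  have hcS : c ∉ (S : Set V) := hc
  obtain ⟨v, hv, hmax⟩ := Set.exists_max_image (G.complComp S c)
    (fun v => (S.filter fun t => G.Adj t v).card) (Set.toFinite _) ⟨c, self_mem_complComp _ _⟩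
  refine ⟨v, hv, fun s hs hsC => ?_⟩
  by_contra hsv
  obtain ⟨w₀, hw₀, hsw₀⟩ := hsC
  have hvS : v ∉ (S : Set V) := notMem_of_mem_complComp hcS hv
  have hSC : ∀ t ∈ S, t ∉ G.complComp S c := fun t ht h =>
    notMem_of_mem_complComp hcS h ht
  rw [← complComp_eq_of_mem hv] at hw₀
  obtain ⟨p₀, hp₀⟩ := exists_walk_of_mem_complComp hvS hw₀
  rw [complComp_eq_of_mem hv] at hp₀
  obtain ⟨w, hw, hsw, hw'⟩ := hG.exists_adj_of_walk (hSC s hs) p₀ hp₀ hsw₀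
  have hlt : (S.filter fun t => G.Adj t v).card < (S.filter fun t => G.Adj t w).card := by
    refine Finset.card_lt_card ⟨fun t ht => ?_, fun hsub => ?_⟩
    · rw [Finset.mem_filter] at ht ⊢
      have hts : t ≠ s := fun h => hsv (h ▸ ht.2)
      exact ⟨ht.1, hw' t (hSC t ht.1) (hS ht.1 hs hts) ht.2⟩
    · exact hsv (Finset.mem_filter.1 (hsub (Finset.mem_filter.2 ⟨hs, hsw⟩))).2
  exact absurd (hmax w hw) (not_le.2 hlt)

end SimpleGraph

/-! ### Non-planarity of the complete graph on five vertices -/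

/-- A nowhere vanishing continuous function on a real normed space has a continuous logarithm. -/
theorem exists_continuous_exp_eq {X : Type*} [NormedAddCommGroup X] [NormedSpace ℝ X] {g : X → ℂ}
    (hg : Continuous g) (h0 : ∀ x, g x ≠ 0) :
    ∃ f : X → ℂ, Continuous f ∧ ∀ x, Complex.exp (f x) = g x := by
  have hsc : IsSimplyConnected (Set.univ : Set X) := by
    have : ContractibleSpace (Set.univ : Set X) :=
      convex_univ.contractibleSpace Set.univ_nonempty
    exact (inferInstance : SimplyConnectedSpace (Set.univ : Set X))
  obtain ⟨f, hf, hfg⟩ := Complex.exists_continuousOn_eqOn_exp_comp hsc isOpen_univ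
    hg.continuousOn (by rintro ⟨x, -, hx⟩; exact h0 x hx)
  exact ⟨f, continuousOn_univ.1 hf, fun x => hfg (Set.mem_univ x)⟩

/-- Two continuous logarithms of the same function have the same increments. -/
theorem sub_eq_sub_of_exp_eq {f g : ℝ → ℂ} (hf : Continuous f) (hg : Continuous g)
    (h : ∀ t, Complex.exp (f t) = Complex.exp (g t)) (a b : ℝ) : f a - f b = g a - g b := by
  have hn : ∀ t, ∃ n : ℤ, f t - g t = n * (2 * Real.pi * Complex.I) := by
    intro t
    obtain ⟨n, hn⟩ := Complex.exp_eq_exp_iff_exists_int.1 (h t)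
    exact ⟨n, by rw [hn]; ring⟩
  choose n hn using hn
  have hpi : (2 * Real.pi * Complex.I : ℂ) ≠ 0 := Complex.two_pi_I_ne_zero
  have hcont : Continuous n := by
    have h1 : Continuous fun t => ((f t - g t) / (2 * Real.pi * Complex.I)).re :=
      Complex.continuous_re.comp ((hf.sub hg).div_const _)
    have h2 : (fun t => ((f t - g t) / (2 * Real.pi * Complex.I)).re) = fun t => (n t : ℝ) := by
      funext t
      rw [hn t, mul_div_cancel_right₀ _ hpi, Complex.intCast_re]
    rw [h2] at h1
    exact Int.isClosedEmbedding_coe_real.isInducing.continuous_iff.2 h1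
  have hab : n a = n b := by
    have := isPreconnected_univ.constant hcont.continuousOn (Set.mem_univ a) (Set.mem_univ b)
    exact this
  have ha := hn a
  have hb := hn b
  rw [hab] at ha
  linear_combination ha - hb

/-- The complete graph on five vertices cannot be drawn in the plane. -/
theorem false_of_five_points (z : Fin 5 → ℂ) (hz : Function.Injective z)
    (γ : Fin 5 → Fin 5 → ℝ → ℂ) (hγ : ∀ i j, i ≠ j → Continuous (γ i j))
    (h0 : ∀ i j, i ≠ j → γ i j 0 = z i) (h1 : ∀ i j, i ≠ j → γ i j 1 = z j)
    (hv : ∀ i j k, i ≠ j → k ≠ i → k ≠ j → ∀ t, γ i j t ≠ z k)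
    (he : ∀ i j k l, i ≠ j → k ≠ l → i ≠ k → i ≠ l → j ≠ k → j ≠ l →
      ∀ s t, γ i j s ≠ γ k l t) : False := by
  have hlift : ∀ i j k, i ≠ j → k ≠ i → k ≠ j →
      ∃ f : ℝ → ℂ, Continuous f ∧ ∀ t, Complex.exp (f t) = γ i j t - z k :=
    fun i j k hij hki hkj => exists_continuous_exp_eq ((hγ i j hij).sub continuous_const)
      (fun t => sub_ne_zero.2 (hv i j k hij hki hkj t))
  choose! f hf hfe using hlift
  -- the increments of the logarithms along the four sides of a square
  have hA : ∀ i j k l, i ≠ j → k ≠ l → i ≠ k → i ≠ l → j ≠ k → j ≠ l →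
      (f i j k 1 - f i j k 0) + (f k l j 1 - f k l j 0) =
      (f i j l 1 - f i j l 0) + (f k l i 1 - f k l i 0) := by
    intro i j k l hij hkl hik hil hjk hjl
    -- Disjoint arcs have a nonvanishing difference, so its logarithm exists on the whole parameter
    -- plane and its increments around the unit square cancel.
    obtain ⟨F, hF, hFe⟩ := exists_continuous_exp_eq (X := ℝ × ℝ)
      (g := fun p => γ i j p.1 - γ k l p.2)
      (((hγ i j hij).comp continuous_fst).sub ((hγ k l hkl).comp continuous_snd))
      (fun p => sub_ne_zero.2 (he i j k l hij hkl hik hil hjk hjl p.1 p.2))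
    have e1 := sub_eq_sub_of_exp_eq (f := f i j k) (g := fun s => F (s, 0))
      (hf i j k hij hik.symm hjk.symm) (by fun_prop)
      (fun t => by rw [hfe i j k hij hik.symm hjk.symm, hFe, h0 k l hkl]) 1 0
    have e2 := sub_eq_sub_of_exp_eq (f := f i j l) (g := fun s => F (s, 1))
      (hf i j l hij hil.symm hjl.symm) (by fun_prop)
      (fun t => by rw [hfe i j l hij hil.symm hjl.symm, hFe, h1 k l hkl]) 1 0
    -- On this side the difference is `z j - γ k l`, the negative of what `f k l j` measures; adding
    -- `πi` to the logarithm corrects the sign.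
    have e3 := sub_eq_sub_of_exp_eq (f := f k l j) (g := fun s => F (1, s) + Real.pi * Complex.I)
      (hf k l j hkl hjk hjl) (by fun_prop)
      (fun t => by
        rw [hfe k l j hkl hjk hjl, Complex.exp_add, hFe, h1 i j hij, Complex.exp_pi_mul_I]
        ring) 1 0
    have e4 := sub_eq_sub_of_exp_eq (f := f k l i) (g := fun s => F (0, s) + Real.pi * Complex.I)
      (hf k l i hkl hik hil) (by fun_prop)
      (fun t => by
        rw [hfe k l i hkl hik hil, Complex.exp_add, hFe, h0 i j hij, Complex.exp_pi_mul_I]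
        ring) 1 0
    linear_combination e1 - e2 + e3 - e4
  -- Opposite directions differ by an odd multiple of `πi`. The logarithms `Θ` of the directions are
  -- chosen so that it is `πi` or `-πi`, according to the order of the indices.
  let ε : Fin 5 → Fin 5 → ℤ := fun a b => if b < a then 1 else -1
  obtain ⟨Θ, hΘ, hΘε⟩ : ∃ Θ : Fin 5 → Fin 5 → ℂ,
      (∀ a b, a ≠ b → Complex.exp (Θ a b) = z b - z a) ∧
      ∀ a b, a ≠ b → Θ a b - Θ b a = ε a b * (Real.pi * Complex.I) := by
    refine ⟨fun a b => if b < a then Complex.log (z a - z b) + Real.pi * Complex.I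
      else Complex.log (z b - z a), ?_, ?_⟩
    · intro a b hab
      dsimp only
      split_ifs with h
      · rw [Complex.exp_add, Complex.exp_log (sub_ne_zero.2 (hz.ne hab)), Complex.exp_pi_mul_I]
        ring
      · rw [Complex.exp_log (sub_ne_zero.2 (hz.ne hab.symm))]
    · intro a b hab
      rcases lt_or_gt_of_ne hab with h | h
      · simp [ε, h, h.not_gt]
      · simp [ε, h, h.not_gt]
  -- The integer `n i j k` counts the extra full turns of the arc from `z i` to `z j` as seen from
  -- `z k`.
  have hn : ∀ i j k, i ≠ j → k ≠ i → k ≠ j → ∃ n : ℤ,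
      f i j k 1 - f i j k 0 = Θ k j - Θ k i + n * (2 * (Real.pi * Complex.I)) := by
    intro i j k hij hki hkj
    obtain ⟨a, ha⟩ := Complex.exp_eq_exp_iff_exists_int.1
      ((hfe i j k hij hki hkj 1).trans ((h1 i j hij).symm ▸ (hΘ k j hkj).symm))
    obtain ⟨b, hb⟩ := Complex.exp_eq_exp_iff_exists_int.1
      ((hfe i j k hij hki hkj 0).trans ((h0 i j hij).symm ▸ (hΘ k i hki).symm))
    exact ⟨a - b, by rw [ha, hb]; push_cast; ring⟩
  choose! n hn using hn
  have key : ∀ i j k l, i ≠ j → k ≠ l → i ≠ k → i ≠ l → j ≠ k → j ≠ l →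
      ε k j - ε l j + ε l i - ε k i + 2 * (n i j k + n k l j - n i j l - n k l i) = 0 := by
    intro i j k l hij hkl hik hil hjk hjl
    have e := hA i j k l hij hkl hik hil hjk hjl
    rw [hn i j k hij hik.symm hjk.symm, hn k l j hkl hjk hjl, hn i j l hij hil.symm hjl.symm,
      hn k l i hkl hik hil] at e
    have hpi : (Real.pi * Complex.I : ℂ) ≠ 0 := by simp [Real.pi_ne_zero]
    have e' : ((ε k j - ε l j + ε l i - ε k i +
        2 * (n i j k + n k l j - n i j l - n k l i) : ℤ) : ℂ) * (Real.pi * Complex.I) = 0 := by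
      push_cast
      linear_combination e - hΘε k j hjk.symm + hΘε l j hjl.symm - hΘε l i hil.symm +
        hΘε k i hik.symm
    exact_mod_cast (mul_eq_zero.1 e').resolve_right hpi
  -- One equation for each of the 15 pairs of disjoint edges. Each `n i j k` with `i < j` occurs in
  -- exactly two of them, so after halving and adding, the `n` cancel modulo 2. The halved `ε` part
  -- is odd exactly when the two index pairs interleave, which happens once for each of the five
  -- 4-subsets. The total is therefore odd, which is impossible.
  have k1 := key 0 1 2 3 (by decide) (by decide) (by decide) (by decide) (by decide) (by decide)
  have k2 := key 0 1 2 4 (by decide) (by decide) (by decide) (by decide) (by decide) (by decide)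
  have k3 := key 0 1 3 4 (by decide) (by decide) (by decide) (by decide) (by decide) (by decide)
  have k4 := key 0 2 1 3 (by decide) (by decide) (by decide) (by decide) (by decide) (by decide)
  have k5 := key 0 2 1 4 (by decide) (by decide) (by decide) (by decide) (by decide) (by decide)
  have k6 := key 0 2 3 4 (by decide) (by decide) (by decide) (by decide) (by decide) (by decide)
  have k7 := key 0 3 1 2 (by decide) (by decide) (by decide) (by decide) (by decide) (by decide)
  have k8 := key 0 3 1 4 (by decide) (by decide) (by decide) (by decide) (by decide) (by decide)
  have k9 := key 0 3 2 4 (by decide) (by decide) (by decide) (by decide) (by decide) (by decide)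
  have k10 := key 0 4 1 2 (by decide) (by decide) (by decide) (by decide) (by decide) (by decide)
  have k11 := key 0 4 1 3 (by decide) (by decide) (by decide) (by decide) (by decide) (by decide)
  have k12 := key 0 4 2 3 (by decide) (by decide) (by decide) (by decide) (by decide) (by decide)
  have k13 := key 1 2 3 4 (by decide) (by decide) (by decide) (by decide) (by decide) (by decide)
  have k14 := key 1 3 2 4 (by decide) (by decide) (by decide) (by decide) (by decide) (by decide)
  have k15 := key 1 4 2 3 (by decide) (by decide) (by decide) (by decide) (by decide) (by decide)
  simp [ε] at k1 k2 k3 k4 k5 k6 k7 k8 k9 k10 k11 k12 k13 k14 k15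
  omega

/-! ### Planar graphs have no 5-clique -/

namespace SimpleGraph

variable {V : Type*} {G : SimpleGraph V}

theorem IsPlanar.cliqueFree_five (hG : G.IsPlanar) : G.CliqueFree 5 := by
  obtain ⟨E⟩ := hG
  by_contra hcl
  obtain ⟨φ⟩ := not_cliqueFree_iff_top_isContained 5 |>.1 hcl
  have hadj : ∀ i j, i ≠ j → G.Adj (φ i) (φ j) := fun i j hij => φ.toHom.map_adj hij
  let e := Complex.orthonormalBasisOneI.repr.symm
  have hg : ∀ i j (hij : i ≠ j), ∃ g : ℝ → ℂ, Continuous g ∧ g 0 = e (E.point (φ i)) ∧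
      g 1 = e (E.point (φ j)) ∧ ∀ t, ∃ x ∈ E.arc ⟨s(φ i, φ j), hadj i j hij⟩, g t = e x := by
    intro i j hij
    obtain ⟨γ, -, hγ⟩ := E.isArc (φ i) (φ j) (hadj i j hij)
    -- Extending the arc by constants beyond `[0, 1]` keeps its values in the arc, so disjointness
    -- holds for all real parameters.
    refine ⟨fun t => e (γ.extend t), e.continuous.comp γ.continuous_extend, by simp, by simp,
      fun t => ⟨γ.extend t, ?_, rfl⟩⟩
    rw [← hγ, ← γ.extend_range]
    exact ⟨t, rfl⟩
  choose! g hgc hg0 hg1 hga using hg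
  refine false_of_five_points (fun i => e (E.point (φ i)))
    (e.injective.comp (E.point_injective.comp φ.injective)) g hgc hg0 hg1 ?_ ?_
  · intro i j k hij hki hkj t ht
    obtain ⟨x, hx, hxt⟩ := hga i j hij t
    obtain rfl := e.injective (hxt.symm.trans ht)
    have := E.mem_of_point_mem_arc _ _ hx
    rcases Sym2.mem_iff.1 this with h | h
    · exact hki (φ.injective h)
    · exact hkj (φ.injective h)
  · intro i j k l hij hkl hik hil hjk hjl s t hst
    obtain ⟨x, hx, hxs⟩ := hga i j hij s
    obtain ⟨y, hy, hyt⟩ := hga k l hkl t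
    obtain rfl := e.injective (hxs.symm.trans (hst.trans hyt))
    obtain ⟨w, ⟨hw1, hw2⟩, -⟩ := E.arc_inter_arc _ _ (fun h => by
      have h' := congrArg Subtype.val h
      have h'' : φ i ∈ s(φ k, φ l) := by
        rw [← show s(φ i, φ j) = s(φ k, φ l) from h']; simp
      rcases Sym2.mem_iff.1 h'' with h | h
      · exact hik (φ.injective h)
      · exact hil (φ.injective h)) ⟨hx, hy⟩
    rcases Sym2.mem_iff.1 hw1 with rfl | rfl <;> rcases Sym2.mem_iff.1 hw2 with h | h
    · exact hik (φ.injective h)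
    · exact hil (φ.injective h)
    · exact hjk (φ.injective h)
    · exact hjl (φ.injective h)

end SimpleGraph

theorem mainTheorem7 {V : Type*} [Fintype V] (G : SimpleGraph V)
    (hG : G.IsKTree 3 ∨ (G.Connected ∧ G.IsChordal ∧ G.IsPlanar)) :
    G.lpt ≤ 2 := by
  rcases hG with h | ⟨hc, hch, hp⟩
  · exact G.lpt_le_two_of_hasCones (h.connected (by norm_num)) h.hasCones h.cliqueFree
  · exact G.lpt_le_two_of_hasCones hc hch.hasCones hp.cliqueFree_five
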